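/- Let $\Omega\subset\mathbb R^2$ be bounded. A map $w=(p,q):\mathbb R^2\setminus\overline\Omega\to\mathbb R^2$ is called exterior $K$-quasiconformal if $p,q\in C^1(\mathbb R^2\setminus\overline\Omega)$ and $$p_1^2+p_2^2+q_1^2+q_2^2\le 2K\,(p_1q_2-p_2q_1)\quad\text{at every point of }\mathbb R^2\setminus\overline\Omega,$$ where $p_i=\partial p/\partial x_i$, $q_i=\partial q/\partial x_i$. **Theorem.** Let $K\ge 1$, let $w$ be exterior $K$-quasiconformal in $\mathbb R^2\setminus\overline\Omega$ with $|w|\le M$ there, and put $\alpha=K-\sqrt{K^2-1}$. Let $R>0$ be such that $|x|\le R$ for all $x\in\Omega$. 1. For every open set $\Omega'$ with $\overline\Omega\subset\Omega'$ and $d=\operatorname{dist}(\Omega,\partial\Omega')$, $$|w(x)-w(y)|\le C\,|x-y|^{\alpha}\quad\text{for all }x,y\in\mathbb R^2\setminus\overline{\Omega'},$$ where $C$ depends only on $K$, $d$ and $M$. 2. $w(x)$ tends to a limit $w(\infty)\in\mathbb R^2$ as $|x|\to\infty$, and for every $\Omega'$ and $d$ as in 1, $$|w(x)-w(\infty)|\le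 C\,|x|^{-\alpha}\quad\text{for all }x\in\mathbb R^2\setminus\overline{\Omega'},\ x\ne 0,$$ where $C$ depends only on $K$, $d$, $M$ and $R$. -/

import Mathlib

open Filter Topology

/-- The Euclidean plane. -/
abbrev Plane : Type := EuclideanSpace ℝ (Fin 2)

/-- The partial derivative `∂f/∂x_i` at `x` of a real function on the plane. -/
noncomputable def partialDeriv (f : Plane → ℝ) (i : Fin 2) (x : Plane) : ℝ :=
  fderiv ℝ f x (EuclideanSpace.single i 1)

/-- The map `w = (p, q)`, with `p = w · 0` and `q = w · 1`, is exterior `K`-quasiconformal in the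
complement of the closure of `Ω`: `p` and `q` are of class `C¹` there, and
`p₁² + p₂² + q₁² + q₂² ≤ 2 K (p₁ q₂ - p₂ q₁)` at every point. Values of `w` on the closure of `Ω`
play no role. -/
structure IsExteriorQuasiconformal (K : ℝ) (Ω : Set Plane) (w : Plane → Plane) : Prop where
  contDiffOn_fst : ContDiffOn ℝ 1 (fun x => w x 0) (closure Ω)ᶜ
  contDiffOn_snd : ContDiffOn ℝ 1 (fun x => w x 1) (closure Ω)ᶜ
  dilatation_le : ∀ x ∈ (closure Ω)ᶜ,
    partialDeriv (fun y => w y 0) 0 x ^ 2 + partialDeriv (fun y => w y 0) 1 x ^ 2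
      + partialDeriv (fun y => w y 1) 0 x ^ 2 + partialDeriv (fun y => w y 1) 1 x ^ 2
    ≤ 2 * K * (partialDeriv (fun y => w y 0) 0 x * partialDeriv (fun y => w y 1) 1 x
        - partialDeriv (fun y => w y 0) 1 x * partialDeriv (fun y => w y 1) 0 x)

/-- `d = dist(s, t)`, the infimum of `|x - y|` over `x ∈ s` and `y ∈ t`. As a greatest lower bound
in `ℝ`, it exists exactly when `s` and `t` are both nonempty. -/
def IsSetDist (s t : Set Plane) (d : ℝ) : Prop :=
  IsGLB (Set.image2 dist s t) d

/-- `Ω' ⊃⊃ Ω` with `dist(Ω, ∂Ω') = d`, where `Ω'` is open. (For bounded `Ω` the closure of `Ω` is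
compact.) -/
structure IsOuterNeighborhood (Ω Ω' : Set Plane) (d : ℝ) : Prop where
  isOpen : IsOpen Ω'
  closure_subset : closure Ω ⊆ Ω'
  dist_frontier : IsSetDist Ω (frontier Ω') d

/-- The exponent `α = K - (K² - 1)^{1/2}`, meant for `K ≥ 1`. -/
noncomputable def qcExponent (K : ℝ) : ℝ := K - Real.sqrt (K ^ 2 - 1)

/-!
In logarithmic polar coordinates `t + iθ` about a point, or about infinity, a quasiconformal map `f` is
a map of the half-cylinder `t < 0` of the same dilatation, the change of coordinates being holomorphic.
Let `E(t)` be the signed area enclosed by the image of the circle at height `t`. Then `E'(t)` is the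
integral of the Jacobian over the circle (`hasDerivAt_enclosedArea`, which needs `f` only of class `C¹`).
The pointwise inequality `α |∂f|² ≤ J`, valid for each partial derivative, and the isoperimetric
inequality give `2αE ≤ E'` (`two_mul_enclosedArea_le`), and the bound on `f` gives `E² ≤ cE'`
(`sq_enclosedArea_le`). The second inequality forces finite-time blow-up unless `E ≥ 0` and `E(-1)` is
bounded; the first then yields `E(t) ≤ C e^{2αt}` (`nonneg_and_le_exp_of_deriv_ineq`). In particular
an isolated singularity where `f` is bounded needs no separate treatment.

The decay of `E` controls the speed of the circle means, so that these converge at the rate `e^{αt}`,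
and by the Courant–Lebesgue argument it bounds the oscillation on some circle in every annulus. So
there are many circles on which `f` is within `C e^{αt}` of its limit (`exists_circle_near_limit`).

For the Hölder estimate, two points at distance `r` have good circles of radii between `r` and `2r`,
and these intersect (`IsQuasiregularOn.exists_holder_const`). At infinity, the bound on good circles is
extended to all points with the Hölder estimate on discs of comparable size, by an iteration over
dyadic scales (`IsQuasiregularOn.exists_decay_const`). No area integrals and no maximum principle are
used.
-/

namespace ExteriorQuasiconformal

open MeasureTheory Set
open scoped Real

/-! ### Integral inequalities on the circle -/

/-- The area form `a ∧ b = Im (ā b)` of the complex plane. -/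
noncomputable def wedge (a b : ℂ) : ℝ := a.re * b.im - a.im * b.re

theorem abs_wedge_le (a b : ℂ) : |wedge a b| ≤ ‖a‖ * ‖b‖ := by
  have h : wedge a b = (starRingEnd ℂ a * b).im := by simp [wedge]; ring
  rw [h]
  refine (Complex.abs_im_le_norm _).trans ?_
  simp

theorem wedge_sub_left (a b c : ℂ) : wedge (a - b) c = wedge a c - wedge b c := by
  simp [wedge]; ring

theorem wedge_smul_left (r : ℝ) (a b : ℂ) : wedge (r • a) b = r * wedge a b := by
  simp [wedge]; ring

theorem wedge_smul_right (r : ℝ) (a b : ℂ) : wedge a (r • b) = r * wedge a b := by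
  simp [wedge]; ring

@[fun_prop]
theorem continuousOn_wedge {X : Type*} [TopologicalSpace X] {f g : X → ℂ} {s : Set X}
    (hf : ContinuousOn f s) (hg : ContinuousOn g s) :
    ContinuousOn (fun x => wedge (f x) (g x)) s := by
  unfold wedge
  exact ((Complex.continuous_re.comp_continuousOn hf).mul
    (Complex.continuous_im.comp_continuousOn hg)).sub
    ((Complex.continuous_im.comp_continuousOn hf).mul
    (Complex.continuous_re.comp_continuousOn hg))

@[fun_prop]
theorem continuous_wedge {X : Type*} [TopologicalSpace X] {f g : X → ℂ}
    (hf : Continuous f) (hg : Continuous g) : Continuous (fun x => wedge (f x) (g x)) := by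
  rw [← continuousOn_univ] at *
  exact continuousOn_wedge hf hg

/-- The Cauchy–Schwarz inequality against the constant `1` on `[0, 2π]`. -/
theorem sq_integral_le {g : ℝ → ℝ} (hg : Continuous g) :
    (∫ x in (0)..(2 * π), g x) ^ 2 ≤ 2 * π * ∫ x in (0)..(2 * π), g x ^ 2 := by
  have hpi := Real.pi_pos
  set A := ∫ x in (0)..(2 * π), g x with hA
  have h0 : 0 ≤ ∫ x in (0)..(2 * π), (g x - A / (2 * π)) ^ 2 :=
    intervalIntegral.integral_nonneg (by positivity) fun x _ => sq_nonneg _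
  have h1 : ∫ x in (0)..(2 * π), (g x - A / (2 * π)) ^ 2
      = (∫ x in (0)..(2 * π), g x ^ 2) - A ^ 2 / (2 * π) := by
    have : ∀ x, (g x - A / (2 * π)) ^ 2
        = g x ^ 2 - (2 * (A / (2 * π)) * g x - (A / (2 * π)) ^ 2) := fun x => by ring
    simp_rw [this]
    rw [intervalIntegral.integral_sub, intervalIntegral.integral_sub,
      intervalIntegral.integral_const_mul, ← hA]
    · simp; field_simp; ring
    all_goals exact Continuous.intervalIntegrable (by fun_prop) _ _
  rw [h1, sub_nonneg, div_le_iff₀ (by positivity)] at h0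
  linarith

/-- **Wirtinger's inequality** on the circle: passing from `g` to `g'` multiplies the `n`-th Fourier
coefficient by `i n`, and the coefficient with `n = 0` vanishes. -/
theorem integral_norm_sq_le_of_integral_eq_zero {g g' : ℝ → ℂ} (hg : ∀ x, HasDerivAt g (g' x) x)
    (hg' : Continuous g') (hper : g (2 * π) = g 0) (hmean : ∫ x in (0)..(2 * π), g x = 0) :
    ∫ x in (0)..(2 * π), ‖g x‖ ^ 2 ≤ ∫ x in (0)..(2 * π), ‖g' x‖ ^ 2 := by
  have hpi := Real.pi_pos
  have hab : (0 : ℝ) < 2 * π := by positivity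
  have hgc : Continuous g := continuous_iff_continuousAt.2 fun x => (hg x).continuousAt
  have hL : ∀ {u : ℝ → ℂ}, Continuous u → MemLp u 2 (volume.restrict (Ioc 0 (2 * π))) := by
    intro u hu
    exact (memLp_two_iff_integrable_sq_norm hu.aestronglyMeasurable).2
      (Continuous.intervalIntegrable (by fun_prop) 0 (2 * π)).1
  have h1 := hasSum_sq_fourierCoeffOn hab (hL hgc)
  have h2 := hasSum_sq_fourierCoeffOn hab (hL hg')
  have hle : ∀ n : ℤ, ‖fourierCoeffOn hab g n‖ ^ 2 ≤ ‖fourierCoeffOn hab g' n‖ ^ 2 := by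
    intro n
    rcases eq_or_ne n 0 with rfl | hn
    · have : fourierCoeffOn hab g 0 = 0 := by
        rw [fourierCoeffOn_eq_integral]
        simp [hmean]
      rw [this]; simp
    · have h := fourierCoeffOn_of_hasDerivAt hab hn (fun x _ => hg x)
        (hg'.intervalIntegrable _ _)
      rw [hper, sub_self, mul_zero, zero_sub] at h
      have h3 : ‖fourierCoeffOn hab g n‖ = ‖fourierCoeffOn hab g' n‖ / |(n : ℝ)| := by
        rw [h]
        simp [abs_of_pos hpi]
        field_simp
      have h4 : (1 : ℝ) ≤ |(n : ℝ)| := by exact_mod_cast Int.one_le_abs hn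
      rw [h3]
      gcongr
      exact div_le_self (norm_nonneg _) h4
  have h3 := hasSum_le hle h1 h2
  simp only [sub_zero, smul_eq_mul] at h3
  exact le_of_mul_le_mul_left h3 (by positivity)

/-- The isoperimetric inequality for a closed curve `g`, with `∫ |g'|²` in place of the squared
length; the curve may wind either way. -/
theorem abs_integral_wedge_le {g g' : ℝ → ℂ} (hg : ∀ x, HasDerivAt g (g' x) x)
    (hg' : Continuous g') (hper : g (2 * π) = g 0) :
    |∫ x in (0)..(2 * π), wedge (g x) (g' x)| ≤ ∫ x in (0)..(2 * π), ‖g' x‖ ^ 2 := by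
  have hpi := Real.pi_pos
  have hgc : Continuous g := continuous_iff_continuousAt.2 fun x => (hg x).continuousAt
  set m : ℂ := (2 * π : ℝ)⁻¹ • ∫ x in (0)..(2 * π), g x with hm
  have hint0 : ∫ x in (0)..(2 * π), g' x = 0 := by
    rw [intervalIntegral.integral_eq_sub_of_hasDerivAt (fun x _ => hg x)
      (hg'.intervalIntegrable _ _), hper, sub_self]
  have hmean : ∫ x in (0)..(2 * π), (g x - m) = 0 := by
    rw [intervalIntegral.integral_sub (hgc.intervalIntegrable _ _) (by simp),
      intervalIntegral.integral_const, hm, smul_smul]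
    rw [sub_zero, mul_inv_cancel₀ (by positivity), one_smul, sub_self]
  have hW := integral_norm_sq_le_of_integral_eq_zero (g := fun x => g x - m)
    (fun x => (hg x).sub_const m) hg' (by simp [hper]) hmean
  have hm0 : ∫ x in (0)..(2 * π), wedge m (g' x) = 0 := by
    have hre : ∫ x in (0)..(2 * π), (g' x).re = 0 := by
      have := Complex.reCLM.intervalIntegral_comp_comm (μ := volume) (hg'.intervalIntegrable 0 (2 * π))
      rw [hint0] at this
      simpa using this
    have him : ∫ x in (0)..(2 * π), (g' x).im = 0 := by
      have := Complex.imCLM.intervalIntegral_comp_comm (μ := volume) (hg'.intervalIntegrable 0 (2 * π))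
      rw [hint0] at this
      simpa using this
    unfold wedge
    rw [intervalIntegral.integral_sub, intervalIntegral.integral_const_mul,
      intervalIntegral.integral_const_mul,
      hre, him]
    · simp
    all_goals exact Continuous.intervalIntegrable (by fun_prop) _ _
  have heq : ∫ x in (0)..(2 * π), wedge (g x) (g' x)
      = ∫ x in (0)..(2 * π), wedge (g x - m) (g' x) := by
    simp_rw [wedge_sub_left]
    rw [intervalIntegral.integral_sub, hm0, sub_zero]
    all_goals exact Continuous.intervalIntegrable (by fun_prop) _ _
  rw [heq]
  calc |∫ x in (0)..(2 * π), wedge (g x - m) (g' x)|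
      ≤ ∫ x in (0)..(2 * π), |wedge (g x - m) (g' x)| :=
        intervalIntegral.abs_integral_le_integral_abs (by positivity)
    _ ≤ ∫ x in (0)..(2 * π), (1 / 2 * ‖g x - m‖ ^ 2 + 1 / 2 * ‖g' x‖ ^ 2) := by
        apply intervalIntegral.integral_mono_on (by positivity)
        · exact Continuous.intervalIntegrable (by fun_prop) _ _
        · exact Continuous.intervalIntegrable (by fun_prop) _ _
        · intro x _
          have := abs_wedge_le (g x - m) (g' x)
          nlinarith [sq_nonneg (‖g x - m‖ - ‖g' x‖)]
    _ = 1 / 2 * (∫ x in (0)..(2 * π), ‖g x - m‖ ^ 2)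
          + 1 / 2 * ∫ x in (0)..(2 * π), ‖g' x‖ ^ 2 := by
        rw [intervalIntegral.integral_add, intervalIntegral.integral_const_mul, intervalIntegral.integral_const_mul]
        all_goals exact Continuous.intervalIntegrable (by fun_prop) _ _
    _ ≤ _ := by linarith

/-! ### A differential inequality with finite-time blow-up -/

/-- `-1/E` grows at least linearly as long as `E ≠ 0`, by `E² ≤ c E'`. -/
theorem sub_le_of_sq_le_mul_deriv {E E' : ℝ → ℝ} {c s t : ℝ} (hst : s ≤ t)
    (hE : ∀ x ∈ Icc s t, HasDerivAt E (E' x) x) (h0 : ∀ x ∈ Icc s t, E x ≠ 0)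
    (h : ∀ x ∈ Icc s t, E x ^ 2 ≤ c * E' x) :
    t - s ≤ c * ((E s)⁻¹ - (E t)⁻¹) := by
  have hd : ∀ x ∈ Icc s t, HasDerivAt (fun y => -(c * (E y)⁻¹) - y)
      (-(c * (-E' x / E x ^ 2)) - 1) x := fun x hx =>
    (((hE x hx).inv (h0 x hx)).const_mul c).neg.sub (hasDerivAt_id x)
  have hmono : MonotoneOn (fun y => -(c * (E y)⁻¹) - y) (Icc s t) := by
    apply monotoneOn_of_hasDerivWithinAt_nonneg (convex_Icc s t)
      (fun x hx => (hd x hx).continuousAt.continuousWithinAt)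
      (fun x hx => (hd x (interior_subset hx)).hasDerivWithinAt)
    intro x hx
    have hx := interior_subset hx
    have hp : 0 < E x ^ 2 := by have := h0 x hx; positivity
    have : 1 ≤ c * E' x / E x ^ 2 := by rw [le_div_iff₀ hp, one_mul]; exact h x hx
    have e : -(c * (-E' x / E x ^ 2)) = c * E' x / E x ^ 2 := by ring
    rw [e]; linarith
  have := hmono (left_mem_Icc.2 hst) (right_mem_Icc.2 hst) hst
  simp only at this
  linarith

/-- Because `-1/E` grows linearly, a negative value of `E` is impossible on a half-line unbounded to
the left, and a large value at `-1` is impossible as `E` lives up to time `0`; the bound at `-1` then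
propagates to the left by `E' ≥ 2αE`. -/
theorem nonneg_and_le_exp_of_deriv_ineq {E E' : ℝ → ℝ} {c α : ℝ} (hc : 0 < c)
    (hE : ∀ x < 0, HasDerivAt E (E' x) x) (h1 : ∀ x < 0, E x ^ 2 ≤ c * E' x)
    (h2 : ∀ x < 0, 2 * α * E x ≤ E' x) :
    (∀ t < 0, 0 ≤ E t) ∧ ∀ t ≤ -1, E t ≤ 2 * c * Real.exp (2 * α) * Real.exp (2 * α * t) := by
  have hE'0 : ∀ x < 0, 0 ≤ E' x := fun x hx => by
    have := (sq_nonneg (E x)).trans (h1 x hx)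
    exact nonneg_of_mul_nonneg_right this hc
  have hmono : MonotoneOn E (Iio 0) := by
    apply monotoneOn_of_hasDerivWithinAt_nonneg (convex_Iio 0)
      (fun x hx => (hE x hx).continuousAt.continuousWithinAt)
      (fun x hx => (hE x (mem_Iio.1 (interior_subset hx))).hasDerivWithinAt)
      fun x hx => hE'0 x (mem_Iio.1 (interior_subset hx))
  have hnn : ∀ t < 0, 0 ≤ E t := by
    intro t ht
    by_contra! hneg
    set s := t + c * (E t)⁻¹ - 1 with hs
    have hinv : (E t)⁻¹ < 0 := inv_lt_zero.2 hneg
    have hst : s ≤ t := by nlinarith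
    have hEx : ∀ x ∈ Icc s t, E x < 0 := fun x hx =>
      (hmono (lt_of_le_of_lt hx.2 ht) ht hx.2).trans_lt hneg
    have := sub_le_of_sq_le_mul_deriv hst (fun x hx => hE x (hx.2.trans_lt ht))
      (fun x hx => (hEx x hx).ne) (fun x hx => h1 x (hx.2.trans_lt ht))
    have h3 : (E s)⁻¹ < 0 := inv_lt_zero.2 (hEx s (left_mem_Icc.2 hst))
    nlinarith
  refine ⟨hnn, fun t ht => ?_⟩
  have hm1 : E (-1) ≤ 2 * c := by
    by_contra! hbig
    have hEx : ∀ x ∈ Icc (-1 : ℝ) (-1 / 2), 0 < E x := fun x hx => by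
      have := hmono (show (-1 : ℝ) ∈ Iio 0 by norm_num)
        (show x ∈ Iio 0 by have := hx.2; simp; linarith) hx.1
      linarith
    have := sub_le_of_sq_le_mul_deriv (by norm_num)
      (fun x hx => hE x (by have := hx.2; linarith))
      (fun x hx => (hEx x hx).ne') (fun x hx => h1 x (by have := hx.2; linarith))
    have h3 : 0 < (E (-1 / 2))⁻¹ := inv_pos.2 (hEx _ (by norm_num))
    have h4 : c * (E (-1))⁻¹ < 1 / 2 := by
      rw [← div_eq_mul_inv, div_lt_iff₀ (by linarith)]; linarith
    nlinarith
  have hd : ∀ x < 0, HasDerivAt (fun y => E y * Real.exp (-(2 * α * y)))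
      (E' x * Real.exp (-(2 * α * x))
        + E x * (Real.exp (-(2 * α * x)) * -(2 * α * 1))) x := fun x hx =>
    (hE x hx).mul (((hasDerivAt_id x).const_mul (2 * α)).neg.exp)
  have hmono2 : MonotoneOn (fun y => E y * Real.exp (-(2 * α * y))) (Iio 0) := by
    apply monotoneOn_of_hasDerivWithinAt_nonneg (convex_Iio 0)
      (fun x hx => (hd x hx).continuousAt.continuousWithinAt)
      (fun x hx => (hd x (mem_Iio.1 (interior_subset hx))).hasDerivWithinAt)
    intro x hx
    have := h2 x (mem_Iio.1 (interior_subset hx))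
    have hp := Real.exp_pos (-(2 * α * x))
    nlinarith
  have := hmono2 (show t ∈ Iio 0 by simp; linarith) (show (-1 : ℝ) ∈ Iio 0 by norm_num) ht
  simp only at this
  rw [Real.exp_neg, ← div_eq_mul_inv, div_le_iff₀ (Real.exp_pos _)] at this
  refine this.trans ?_
  have e : -(2 * α * -1) = 2 * α := by ring
  rw [e]
  gcongr

/-! ### Quasiregular maps of a half-cylinder -/

/-- The map `f` is `C¹`, bounded by `1` and quasiregular on the half-cylinder
`{(t, θ) | t < 0, θ mod 2π}`, with partial derivatives `f₁` in `t` and `f₂` in `θ`. Quasiregularity is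
encoded by the domination of the squared partial derivatives by `α⁻¹` times the Jacobian. -/
structure IsQuasiregularOnCylinder (α : ℝ) (f f₁ f₂ : ℝ → ℝ → ℂ) : Prop where
  hasDerivAt_fst : ∀ t < 0, ∀ θ, HasDerivAt (fun s => f s θ) (f₁ t θ) t
  hasDerivAt_snd : ∀ t < 0, ∀ θ, HasDerivAt (f t) (f₂ t θ) θ
  continuousOn_fst : ContinuousOn (Function.uncurry f₁) (Iio 0 ×ˢ univ)
  continuousOn_snd : ContinuousOn (Function.uncurry f₂) (Iio 0 ×ˢ univ)
  periodic : ∀ t < 0, Function.Periodic (f t) (2 * π)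
  norm_le_one : ∀ t < 0, ∀ θ, ‖f t θ‖ ≤ 1
  fst_le : ∀ t < 0, ∀ θ, α * ‖f₁ t θ‖ ^ 2 ≤ wedge (f₁ t θ) (f₂ t θ)
  snd_le : ∀ t < 0, ∀ θ, α * ‖f₂ t θ‖ ^ 2 ≤ wedge (f₁ t θ) (f₂ t θ)

/-- The signed area enclosed by the image of the circle at height `t`. -/
noncomputable def enclosedArea (f f₂ : ℝ → ℝ → ℂ) (t : ℝ) : ℝ :=
  1 / 2 * ∫ θ in (0)..(2 * π), wedge (f t θ) (f₂ t θ)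

/-- The integral of the Jacobian over the circle at height `t`. -/
noncomputable def circleJacobian (f₁ f₂ : ℝ → ℝ → ℂ) (t : ℝ) : ℝ :=
  ∫ θ in (0)..(2 * π), wedge (f₁ t θ) (f₂ t θ)

/-- The mean of `f` over the circle at height `t`. -/
noncomputable def circleMean (f : ℝ → ℝ → ℂ) (t : ℝ) : ℂ :=
  (2 * π)⁻¹ • ∫ θ in (0)..(2 * π), f t θ

namespace IsQuasiregularOnCylinder

variable {α : ℝ} {f f₁ f₂ : ℝ → ℝ → ℂ}

theorem continuous (h : IsQuasiregularOnCylinder α f f₁ f₂) {t : ℝ} (ht : t < 0) :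
    Continuous (f t) :=
  continuous_iff_continuousAt.2 fun θ => (h.hasDerivAt_snd t ht θ).continuousAt

theorem continuous_fst (h : IsQuasiregularOnCylinder α f f₁ f₂) {t : ℝ} (ht : t < 0) :
    Continuous (f₁ t) :=
  h.continuousOn_fst.comp_continuous (f := fun θ => (t, θ)) (by fun_prop) fun _ => ⟨ht, trivial⟩

theorem continuous_snd (h : IsQuasiregularOnCylinder α f f₁ f₂) {t : ℝ} (ht : t < 0) :
    Continuous (f₂ t) :=
  h.continuousOn_snd.comp_continuous (f := fun θ => (t, θ)) (by fun_prop) fun _ => ⟨ht, trivial⟩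

/-- The partial derivatives are bounded near each circle. -/
theorem exists_bound {g : ℝ → ℝ → ℂ} (hg : ContinuousOn (Function.uncurry g) (Iio 0 ×ˢ univ))
    {t : ℝ} (ht : t < 0) :
    ∃ C, ∀ s ∈ Icc (t - 1) (t / 2), ∀ θ ∈ Icc 0 (2 * π), ‖g s θ‖ ≤ C := by
  have hK : IsCompact (Icc (t - 1) (t / 2) ×ˢ Icc 0 (2 * π)) := isCompact_Icc.prod isCompact_Icc
  obtain ⟨C, hC⟩ := hK.exists_bound_of_continuousOn (hg.mono (by
    rintro ⟨s, θ⟩ ⟨hs, -⟩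
    exact ⟨by have := hs.2; simp only [mem_Iio]; linarith, trivial⟩))
  exact ⟨C, fun s hs θ hθ => hC (s, θ) ⟨hs, hθ⟩⟩

theorem hasDerivAt_circleMean (h : IsQuasiregularOnCylinder α f f₁ f₂) {t : ℝ} (ht : t < 0) :
    HasDerivAt (circleMean f) ((2 * π)⁻¹ • ∫ θ in (0)..(2 * π), f₁ t θ) t := by
  have hpi := Real.pi_pos
  obtain ⟨C, hC⟩ := exists_bound h.continuousOn_fst ht
  have hs : Ioo (t - 1) (t / 2) ∈ 𝓝 t := Ioo_mem_nhds (by linarith) (by linarith)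
  have hneg : ∀ s ∈ Ioo (t - 1) (t / 2), s < 0 := fun s hs => by have := hs.2; linarith
  refine HasDerivAt.const_smul (2 * π)⁻¹ (intervalIntegral.hasDerivAt_integral_of_dominated_loc_of_deriv_le
    (F := f) (F' := f₁) (bound := fun _ => C) hs ?_ ?_ ?_ ?_ ?_ ?_).2
  · filter_upwards [hs] with s hs
    exact (h.continuous (hneg s hs)).aestronglyMeasurable
  · exact (h.continuous ht).intervalIntegrable _ _
  · exact (h.continuous_fst ht).aestronglyMeasurable
  · refine ae_of_all _ fun θ hθ s hs => hC s (Ioo_subset_Icc_self hs) θ ?_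
    rw [uIoc_of_le (by positivity)] at hθ
    exact Ioc_subset_Icc_self hθ
  · simp
  · exact ae_of_all _ fun θ _ s hs => h.hasDerivAt_fst s (hneg s hs) θ

/-- Two circles: the increment of the enclosed area, after an integration by parts in `θ` that moves
all differences onto `f` itself. Hence no second derivatives are needed to differentiate the area. -/
theorem enclosedArea_sub (h : IsQuasiregularOnCylinder α f f₁ f₂) {s t : ℝ} (hs : s < 0)
    (ht : t < 0) :
    enclosedArea f f₂ s - enclosedArea f f₂ t
      = 1 / 2 * ∫ θ in (0)..(2 * π), wedge (f s θ - f t θ) (f₂ s θ + f₂ t θ) := by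
  have c1 := h.continuous hs
  have c2 := h.continuous ht
  have c3 := h.continuous_snd hs
  have c4 := h.continuous_snd ht
  have hre : ∀ r < 0, ∀ θ, HasDerivAt (fun x => (f r x).re) (f₂ r θ).re θ := fun r hr θ =>
    Complex.reCLM.hasFDerivAt.comp_hasDerivAt θ (h.hasDerivAt_snd r hr θ)
  have him : ∀ r < 0, ∀ θ, HasDerivAt (fun x => (f r x).im) (f₂ r θ).im θ := fun r hr θ =>
    Complex.imCLM.hasFDerivAt.comp_hasDerivAt θ (h.hasDerivAt_snd r hr θ)
  have hparts : ∫ θ in (0)..(2 * π), (wedge (f t θ) (f₂ s θ) - wedge (f s θ) (f₂ t θ)) = 0 := by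
    rw [intervalIntegral.integral_eq_sub_of_hasDerivAt (f := fun θ => wedge (f t θ) (f s θ))]
    · have p1 := (h.periodic s hs) 0
      have p2 := (h.periodic t ht) 0
      rw [zero_add] at p1 p2
      rw [p1, p2, sub_self]
    · intro θ _
      refine (((hre t ht θ).mul (him s hs θ)).sub ((him t ht θ).mul (hre s hs θ))).congr_deriv ?_
      simp only [wedge]; ring
    · exact Continuous.intervalIntegrable (by fun_prop) _ _
  unfold enclosedArea
  rw [← mul_sub, ← intervalIntegral.integral_sub]
  · congr 1
    rw [← sub_eq_zero, ← intervalIntegral.integral_sub, ← hparts]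
    · congr 1; ext θ; simp only [wedge, Complex.sub_re, Complex.sub_im, Complex.add_re,
        Complex.add_im]; ring
    all_goals exact Continuous.intervalIntegrable (by fun_prop) _ _
  all_goals exact Continuous.intervalIntegrable (by fun_prop) _ _

/-- Stokes' theorem in differential form. -/
theorem hasDerivAt_enclosedArea (h : IsQuasiregularOnCylinder α f f₁ f₂) {t : ℝ} (ht : t < 0) :
    HasDerivAt (enclosedArea f f₂) (circleJacobian f₁ f₂ t) t := by
  have hpi := Real.pi_pos
  obtain ⟨C, hC⟩ := exists_bound h.continuousOn_fst ht
  obtain ⟨C', hC'⟩ := exists_bound h.continuousOn_snd ht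
  have hmem : Ioo (t - 1) (t / 2) ∈ 𝓝[≠] t :=
    mem_nhdsWithin_of_mem_nhds (Ioo_mem_nhds (by linarith) (by linarith))
  have hneg : ∀ s ∈ Icc (t - 1) (t / 2), s < 0 := fun s hs => by have := hs.2; linarith
  have htm : t ∈ Icc (t - 1) (t / 2) := ⟨by linarith, by linarith⟩
  rw [hasDerivAt_iff_tendsto_slope]
  have hslope : ∀ᶠ s in 𝓝[≠] t, slope (enclosedArea f f₂) t s
      = ∫ θ in (0)..(2 * π), 1 / 2 * wedge (slope (fun r => f r θ) t s) (f₂ s θ + f₂ t θ) := by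
    filter_upwards [hmem] with s hs
    have hs0 := hneg s (Ioo_subset_Icc_self hs)
    rw [slope_def_field, h.enclosedArea_sub hs0 ht, div_eq_inv_mul,
      ← intervalIntegral.integral_const_mul, ← intervalIntegral.integral_const_mul]
    congr 1; ext θ
    rw [slope_def_module, wedge_smul_left]; ring
  refine Tendsto.congr' (hslope.mono fun _ h => h.symm) ?_
  refine intervalIntegral.tendsto_integral_filter_of_dominated_convergence
    (fun _ => 1 / 2 * (C * (C' + C'))) ?_ ?_ ?_ ?_
  · filter_upwards [hmem] with s hs
    have hs0 := hneg s (Ioo_subset_Icc_self hs)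
    have c1 := h.continuous hs0
    have c2 := h.continuous ht
    have c3 := h.continuous_snd hs0
    have c4 := h.continuous_snd ht
    simp only [slope_def_module]
    exact Continuous.aestronglyMeasurable (by fun_prop)
  · filter_upwards [hmem, self_mem_nhdsWithin] with s hs hst
    refine ae_of_all _ fun θ hθ => ?_
    rw [uIoc_of_le (by positivity)] at hθ
    have hθ := Ioc_subset_Icc_self hθ
    have hs := Ioo_subset_Icc_self hs
    have h1 : ‖slope (fun r => f r θ) t s‖ ≤ C := by
      have := (convex_Icc (t - 1) (t / 2)).norm_image_sub_le_of_norm_hasDerivWithin_le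
        (f := fun r => f r θ) (f' := fun r => f₁ r θ) (C := C)
        (fun r hr => (h.hasDerivAt_fst r (hneg r hr) θ).hasDerivWithinAt)
        (fun r hr => hC r hr θ hθ) htm hs
      rw [slope_def_module, norm_smul, norm_inv, inv_mul_le_iff₀ (norm_pos_iff.2 (sub_ne_zero.2 hst))]
      rwa [mul_comm] at this
    have h2 : ‖f₂ s θ + f₂ t θ‖ ≤ C' + C' :=
      (norm_add_le _ _).trans (add_le_add (hC' s hs θ hθ) (hC' t htm θ hθ))
    rw [norm_mul, Real.norm_eq_abs, Real.norm_eq_abs, abs_of_pos (by norm_num : (0 : ℝ) < 1 / 2)]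
    refine mul_le_mul_of_nonneg_left ((abs_wedge_le _ _).trans ?_) (by norm_num)
    exact mul_le_mul h1 h2 (norm_nonneg _) ((norm_nonneg _).trans h1)
  · simp
  · refine ae_of_all _ fun θ _ => ?_
    have t1 : Tendsto (fun s => slope (fun r => f r θ) t s) (𝓝[≠] t) (𝓝 (f₁ t θ)) :=
      hasDerivAt_iff_tendsto_slope.1 (h.hasDerivAt_fst t ht θ)
    have t2 : Tendsto (fun s => f₂ s θ) (𝓝[≠] t) (𝓝 (f₂ t θ)) := by
      have hc : ContinuousAt (Function.uncurry f₂) (t, θ) :=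
        h.continuousOn_snd.continuousAt
          ((isOpen_Iio.prod isOpen_univ).mem_nhds ⟨ht, trivial⟩)
      have : ContinuousAt (fun s => f₂ s θ) t :=
        ContinuousAt.comp (f := fun s => (s, θ)) hc (by fun_prop)
      exact this.tendsto.mono_left nhdsWithin_le_nhds
    have t3 := t2.add_const (f₂ t θ)
    have hcont : Continuous fun z : ℂ × ℂ => 1 / 2 * wedge z.1 z.2 := by fun_prop
    have e : wedge (f₁ t θ) (f₂ t θ) = 1 / 2 * wedge (f₁ t θ) (f₂ t θ + f₂ t θ) := by
      simp only [wedge, Complex.add_re, Complex.add_im]; ring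
    rw [e]
    exact (hcont.tendsto (f₁ t θ, f₂ t θ + f₂ t θ)).comp (t1.prodMk_nhds t3)

theorem integral_norm_sq_fst_le (h : IsQuasiregularOnCylinder α f f₁ f₂) {t : ℝ} (ht : t < 0) :
    α * ∫ θ in (0)..(2 * π), ‖f₁ t θ‖ ^ 2 ≤ circleJacobian f₁ f₂ t := by
  have hpi := Real.pi_pos
  have c3 := h.continuous_fst ht
  have c4 := h.continuous_snd ht
  rw [← intervalIntegral.integral_const_mul]
  exact intervalIntegral.integral_mono_on (by positivity)
    (Continuous.intervalIntegrable (by fun_prop) _ _)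
    (Continuous.intervalIntegrable (by fun_prop) _ _) fun θ _ => h.fst_le t ht θ

theorem integral_norm_sq_snd_le (h : IsQuasiregularOnCylinder α f f₁ f₂) {t : ℝ} (ht : t < 0) :
    α * ∫ θ in (0)..(2 * π), ‖f₂ t θ‖ ^ 2 ≤ circleJacobian f₁ f₂ t := by
  have hpi := Real.pi_pos
  have c3 := h.continuous_fst ht
  have c4 := h.continuous_snd ht
  rw [← intervalIntegral.integral_const_mul]
  exact intervalIntegral.integral_mono_on (by positivity)
    (Continuous.intervalIntegrable (by fun_prop) _ _)
    (Continuous.intervalIntegrable (by fun_prop) _ _) fun θ _ => h.snd_le t ht θ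

theorem sq_integral_norm_snd_le (h : IsQuasiregularOnCylinder α f f₁ f₂) (hα : 0 < α) {t : ℝ}
    (ht : t < 0) :
    (∫ θ in (0)..(2 * π), ‖f₂ t θ‖) ^ 2 ≤ 2 * π / α * circleJacobian f₁ f₂ t := by
  have c4 := h.continuous_snd ht
  refine (sq_integral_le (g := fun θ => ‖f₂ t θ‖) (by fun_prop)).trans ?_
  rw [div_mul_eq_mul_div, le_div_iff₀ hα, mul_assoc, mul_comm _ α]
  exact mul_le_mul_of_nonneg_left (h.integral_norm_sq_snd_le ht) (by positivity)

theorem two_mul_enclosedArea_le (h : IsQuasiregularOnCylinder α f f₁ f₂) (hα : 0 < α) {t : ℝ}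
    (ht : t < 0) : 2 * α * enclosedArea f f₂ t ≤ circleJacobian f₁ f₂ t := by
  have h1 := abs_integral_wedge_le (h.hasDerivAt_snd t ht) (h.continuous_snd ht)
    (by simpa using h.periodic t ht 0)
  have h2 := h.integral_norm_sq_snd_le ht
  have h3 := (le_abs_self _).trans h1
  have h4 := mul_le_mul_of_nonneg_left h3 hα.le
  unfold enclosedArea
  linarith

theorem sq_enclosedArea_le (h : IsQuasiregularOnCylinder α f f₁ f₂) (hα : 0 < α) {t : ℝ}
    (ht : t < 0) : enclosedArea f f₂ t ^ 2 ≤ π / (2 * α) * circleJacobian f₁ f₂ t := by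
  have hpi := Real.pi_pos
  have c1 := h.continuous ht
  have c4 := h.continuous_snd ht
  have h1 : |∫ θ in (0)..(2 * π), wedge (f t θ) (f₂ t θ)| ≤ ∫ θ in (0)..(2 * π), ‖f₂ t θ‖ := by
    refine (intervalIntegral.abs_integral_le_integral_abs (by positivity)).trans ?_
    apply intervalIntegral.integral_mono_on (by positivity)
      (Continuous.intervalIntegrable (by fun_prop) _ _)
      (Continuous.intervalIntegrable (by fun_prop) _ _)
    intro θ _
    refine (abs_wedge_le _ _).trans ?_
    have := mul_le_mul_of_nonneg_right (h.norm_le_one t ht θ) (norm_nonneg (f₂ t θ))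
    rwa [one_mul] at this
  have h2 := pow_le_pow_left₀ (abs_nonneg _) h1 2
  have h3 := h.sq_integral_norm_snd_le hα ht
  rw [sq_abs] at h2
  have h4 : π / (2 * α) * circleJacobian f₁ f₂ t
      = 1 / 4 * (2 * π / α * circleJacobian f₁ f₂ t) := by field_simp; ring
  rw [h4, enclosedArea, mul_pow]
  linarith

/-! ### Decay of the enclosed area and convergence of the circle means -/

theorem norm_sub_circleMean_le (h : IsQuasiregularOnCylinder α f f₁ f₂) {t : ℝ} (ht : t < 0)
    (θ : ℝ) : ‖f t θ - circleMean f t‖ ≤ ∫ x in (0)..(2 * π), ‖f₂ t x‖ := by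
  have hpi := Real.pi_pos
  have c1 := h.continuous ht
  have c4 := h.continuous_snd ht
  set S := ∫ x in (0)..(2 * π), ‖f₂ t x‖
  have hosc : ∀ x ∈ Icc 0 (2 * π), ∀ y ∈ Icc 0 (2 * π), x ≤ y → ‖f t y - f t x‖ ≤ S := by
    intro x hx y hy hxy
    rw [← intervalIntegral.integral_eq_sub_of_hasDerivAt (fun x _ => h.hasDerivAt_snd t ht x)
      (c4.intervalIntegrable _ _)]
    refine (intervalIntegral.norm_integral_le_integral_norm hxy).trans ?_
    exact intervalIntegral.integral_mono_interval hx.1 hxy hy.2 (ae_of_all _ fun _ => norm_nonneg _)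
      (c4.norm.intervalIntegrable _ _)
  have hosc' : ∀ x ∈ Icc 0 (2 * π), ∀ y ∈ Icc 0 (2 * π), ‖f t x - f t y‖ ≤ S := by
    intro x hx y hy
    rcases le_total x y with hxy | hxy
    · rw [norm_sub_rev]; exact hosc x hx y hy hxy
    · exact hosc y hy x hx hxy
  obtain ⟨y, hy, hfy⟩ := (h.periodic t ht).exists_mem_Ico₀ (by positivity) θ
  rw [hfy]
  have hmean : f t y - circleMean f t = (2 * π)⁻¹ • ∫ x in (0)..(2 * π), (f t y - f t x) := by
    rw [intervalIntegral.integral_sub (by simp) (c1.intervalIntegrable _ _),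
      intervalIntegral.integral_const, smul_sub, smul_smul, sub_zero,
      inv_mul_cancel₀ (by positivity), one_smul, circleMean]
  rw [hmean, norm_smul, norm_inv, Real.norm_eq_abs, abs_of_pos (by positivity : 0 < 2 * π),
    inv_mul_le_iff₀ (by positivity)]
  have := intervalIntegral.norm_integral_le_of_norm_le_const (a := 0) (b := 2 * π)
    (f := fun x => f t y - f t x) (C := S) fun x hx => by
      rw [uIoc_of_le (by positivity)] at hx
      exact hosc' y (Ico_subset_Icc_self hy) x (Ioc_subset_Icc_self hx)
  rwa [sub_zero, abs_of_pos (by positivity), mul_comm S] at this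

/-- The constant in the decay `E(t) ≤ B e^{2αt}` of the enclosed area. -/
noncomputable def areaConst (α : ℝ) : ℝ := 2 * (π / (2 * α)) * Real.exp (2 * α)

theorem areaConst_pos (hα : 0 < α) : 0 < areaConst α := by
  have := Real.pi_pos
  unfold areaConst; positivity

theorem enclosedArea_bounds (h : IsQuasiregularOnCylinder α f f₁ f₂) (hα : 0 < α) :
    (∀ t < 0, 0 ≤ enclosedArea f f₂ t) ∧
      ∀ t ≤ -1, enclosedArea f f₂ t ≤ areaConst α * Real.exp (2 * α * t) :=
  nonneg_and_le_exp_of_deriv_ineq (div_pos Real.pi_pos (by positivity))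
    (fun _ hx => h.hasDerivAt_enclosedArea hx) (fun _ hx => h.sq_enclosedArea_le hα hx)
    (fun _ hx => h.two_mul_enclosedArea_le hα hx)

theorem norm_deriv_circleMean_le (h : IsQuasiregularOnCylinder α f f₁ f₂) (hα : 0 < α) {t : ℝ}
    (ht : t < 0) :
    ‖(2 * π)⁻¹ • ∫ θ in (0)..(2 * π), f₁ t θ‖
      ≤ circleJacobian f₁ f₂ t * Real.exp (-(α * t)) / α + Real.exp (α * t) := by
  have hpi := Real.pi_pos
  have hpi3 := Real.pi_gt_three
  have c3 := h.continuous_fst ht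
  have h1 := h.integral_norm_sq_fst_le ht
  set D := circleJacobian f₁ f₂ t
  have h2 := sq_integral_le (g := fun θ => ‖f₁ t θ‖) (by fun_prop)
  set S := ∫ θ in (0)..(2 * π), ‖f₁ t θ‖
  set Q := ∫ θ in (0)..(2 * π), ‖f₁ t θ‖ ^ 2
  have hS : ‖∫ θ in (0)..(2 * π), f₁ t θ‖ ≤ S :=
    intervalIntegral.norm_integral_le_integral_norm (by positivity)
  rw [norm_smul, norm_inv, Real.norm_eq_abs, abs_of_pos (by positivity : 0 < 2 * π),
    inv_mul_le_iff₀ (by positivity)]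
  refine hS.trans ?_
  have hQ : Q ≤ D / α := by rw [le_div_iff₀ hα, mul_comm]; exact h1
  have hQ0 : 0 ≤ Q := intervalIntegral.integral_nonneg (by positivity) fun _ _ => by positivity
  have hexp : Real.exp (-(α * t)) * Real.exp (α * t) = 1 := by rw [← Real.exp_add]; simp
  set u := Real.exp (α * t)
  set v := Real.exp (-(α * t))
  have hu : 0 < u := Real.exp_pos _
  have hv : 0 < v := Real.exp_pos _
  have e : D * v / α = D / α * v := by ring
  rw [e]
  set q := D / α
  have hq0 : 0 ≤ q := hQ0.trans hQ
  -- the weights `u` and `v = 1/u` turn the square root of `q` into a sum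
  have hamgm : 4 * q ≤ (q * v + u) ^ 2 := by
    have : 4 * q = 4 * ((q * v) * u) := by rw [mul_assoc q, hexp, mul_one]
    nlinarith [sq_nonneg (q * v - u)]
  refine le_of_sq_le_sq ?_ (by positivity)
  calc S ^ 2 ≤ 2 * π * q := h2.trans (by gcongr)
    _ ≤ (2 * π) ^ 2 * (4 * q) := by nlinarith [mul_nonneg hpi.le hq0]
    _ ≤ (2 * π) ^ 2 * (q * v + u) ^ 2 := by gcongr
    _ = (2 * π * (q * v + u)) ^ 2 := by ring

/-- The mean values converge as `t → -∞`, because their speed is dominated by the derivative of the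
increasing function `H`, which tends to `0`. -/
theorem norm_circleMean_sub_le (h : IsQuasiregularOnCylinder α f f₁ f₂) (hα : 0 < α) {s t : ℝ}
    (hst : s ≤ t) (ht : t ≤ -1) :
    ‖circleMean f t - circleMean f s‖ ≤ (2 * areaConst α + 1) / α * Real.exp (α * t) := by
  obtain ⟨hE0, hE⟩ := h.enclosedArea_bounds hα
  have hB := areaConst_pos hα
  set B := areaConst α
  set H : ℝ → ℝ := fun x => (enclosedArea f f₂ x * Real.exp (-(α * x)) + B * Real.exp (α * x)
    + Real.exp (α * x)) / α with hH
  have hHd : ∀ x < 0, HasDerivAt H ((circleJacobian f₁ f₂ x * Real.exp (-(α * x))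
      + enclosedArea f f₂ x * (Real.exp (-(α * x)) * -(α * 1))
      + B * (Real.exp (α * x) * (α * 1)) + Real.exp (α * x) * (α * 1)) / α) x := by
    intro x hx
    have e1 : HasDerivAt (fun y => Real.exp (α * y)) (Real.exp (α * x) * (α * 1)) x :=
      ((hasDerivAt_id x).const_mul α).exp
    have e2 : HasDerivAt (fun y => Real.exp (-(α * y))) (Real.exp (-(α * x)) * -(α * 1)) x :=
      ((hasDerivAt_id x).const_mul α).neg.exp
    exact ((((h.hasDerivAt_enclosedArea hx).mul e2).add (e1.const_mul B)).add e1).div_const α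
  have hsplit : ∀ x, Real.exp (2 * α * x) * Real.exp (-(α * x)) = Real.exp (α * x) := fun x => by
    rw [← Real.exp_add]; ring_nf
  have hEexp : ∀ x ≤ -1, enclosedArea f f₂ x * Real.exp (-(α * x)) ≤ B * Real.exp (α * x) := by
    intro x hx
    rw [← hsplit, ← mul_assoc]
    exact mul_le_mul_of_nonneg_right (hE x hx) (Real.exp_pos _).le
  have key := image_norm_le_of_norm_deriv_right_le_deriv_boundary'
    (f := fun x => circleMean f x - circleMean f s)
    (f' := fun x => (2 * π)⁻¹ • ∫ θ in (0)..(2 * π), f₁ x θ) (a := s) (b := t)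
    (B := fun x => H x - H s)
    (B' := fun x => (circleJacobian f₁ f₂ x * Real.exp (-(α * x))
      + enclosedArea f f₂ x * (Real.exp (-(α * x)) * -(α * 1))
      + B * (Real.exp (α * x) * (α * 1)) + Real.exp (α * x) * (α * 1)) / α)
    (fun x hx => ((h.hasDerivAt_circleMean
      (by have := hx.2; linarith)).sub_const _).continuousAt.continuousWithinAt)
    (fun x hx => ((h.hasDerivAt_circleMean
      (by have := hx.2; linarith)).sub_const _).hasDerivWithinAt)
    (by simp)
    (fun x hx => ((hHd x (by have := hx.2; linarith)).sub_const _).continuousAt.continuousWithinAt)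
    (fun x hx => ((hHd x (by have := hx.2; linarith)).sub_const _).hasDerivWithinAt)
    (fun x hx => by
      have hx1 : x ≤ -1 := by have := hx.2; linarith
      refine (h.norm_deriv_circleMean_le hα (by linarith)).trans ?_
      have := mul_le_mul_of_nonneg_left (hEexp x hx1) hα.le
      rw [le_div_iff₀ hα, add_mul, div_mul_cancel₀ _ hα.ne']
      linarith) (right_mem_Icc.2 hst)
  have hs0 : 0 ≤ H s := by
    have := hE0 s (by linarith)
    simp only [hH]; positivity
  have ht0 : H t ≤ (2 * B + 1) / α * Real.exp (α * t) := by
    have := hEexp t ht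
    simp only [hH]
    rw [div_mul_eq_mul_div]
    gcongr
    linarith
  linarith

theorem exists_limit_circleMean (h : IsQuasiregularOnCylinder α f f₁ f₂) (hα : 0 < α) :
    ∃ l : ℂ, ∀ t ≤ -1,
      ‖circleMean f t - l‖ ≤ (2 * areaConst α + 1) / α * Real.exp (α * t) := by
  set C := (2 * areaConst α + 1) / α
  have hlim : Tendsto (fun n : ℕ => C * Real.exp (α * -((n : ℝ) + 1))) atTop (𝓝 0) := by
    rw [← mul_zero C]
    refine Tendsto.const_mul C (Real.tendsto_exp_atBot.comp ?_)
    refine Tendsto.const_mul_atBot hα (tendsto_neg_atTop_atBot.comp ?_)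
    exact tendsto_atTop_add_const_right _ _ tendsto_natCast_atTop_atTop
  have hc : CauchySeq fun n : ℕ => circleMean f (-((n : ℝ) + 1)) := by
    refine cauchySeq_of_le_tendsto_0' _ (fun n m hnm => ?_) hlim
    have hnm' : (n : ℝ) ≤ m := by exact_mod_cast hnm
    rw [dist_eq_norm]
    exact h.norm_circleMean_sub_le hα (by linarith) (by have := n.cast_nonneg (α := ℝ); linarith)
  obtain ⟨l, hl⟩ := cauchySeq_tendsto_of_complete hc
  refine ⟨l, fun t ht => ?_⟩
  refine le_of_tendsto (hl.const_sub (circleMean f t)).norm ?_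
  obtain ⟨N, hN⟩ := exists_nat_ge (-t)
  filter_upwards [eventually_ge_atTop N] with n hn
  have hn' : (N : ℝ) ≤ n := by exact_mod_cast hn
  exact h.norm_circleMean_sub_le hα (by linarith) ht

/-- The Courant–Lebesgue argument: among the circles at heights between `t` and `t + δ` there is one
on which `f` is exponentially close to the limit of its mean values. -/
theorem exists_circle_near_limit (hα : 0 < α) :
    ∃ C > 0, ∀ f f₁ f₂ : ℝ → ℝ → ℂ, IsQuasiregularOnCylinder α f f₁ f₂ →
      ∃ l : ℂ, ∀ t ≤ -2, ∀ δ, 0 < δ → δ ≤ 1 → ∃ s ∈ Icc t (t + δ), ∀ θ,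
        ‖f s θ - l‖ ≤ C / δ * Real.exp (α * t) := by
  have hpi := Real.pi_pos
  have hB := areaConst_pos hα
  set B := areaConst α with hBdef
  set D := 2 * π / α * (B * Real.exp (2 * α)) with hD
  set C₁ := (2 * B + 1) / α with hC1
  have hD0 : 0 < D := by positivity
  have hC10 : 0 < C₁ := by positivity
  refine ⟨√D + C₁ * Real.exp α, by positivity, fun f f₁ f₂ h => ?_⟩
  obtain ⟨l, hl⟩ := h.exists_limit_circleMean hα
  refine ⟨l, fun t ht δ hδ hδ1 => ?_⟩
  obtain ⟨hE0, hE⟩ := h.enclosedArea_bounds hα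
  obtain ⟨s, hs, hslope⟩ := exists_hasDerivAt_eq_slope (enclosedArea f f₂) (circleJacobian f₁ f₂)
    (by linarith : t < t + δ)
    (fun x hx => (h.hasDerivAt_enclosedArea
      (by have := hx.2; linarith)).continuousAt.continuousWithinAt)
    (fun x hx => h.hasDerivAt_enclosedArea (by have := hx.2; linarith))
  have hs1 : s ≤ t + 1 := by have := hs.2; linarith
  have hs0 : s < 0 := by linarith
  refine ⟨s, Ioo_subset_Icc_self hs, fun θ => ?_⟩
  have hJ : circleJacobian f₁ f₂ s ≤ B * Real.exp (2 * α) * Real.exp (α * t) ^ 2 / δ := by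
    rw [hslope, add_sub_cancel_left]
    gcongr
    have h1 := hE0 t (by linarith)
    have h2 := hE (t + δ) (by linarith)
    have h3 : Real.exp (2 * α * (t + δ)) ≤ Real.exp (2 * α) * Real.exp (α * t) ^ 2 := by
      rw [← Real.exp_nat_mul, ← Real.exp_add]
      apply Real.exp_le_exp.2
      push_cast
      nlinarith
    have h4 := mul_le_mul_of_nonneg_left h3 hB.le
    linarith
  have hL : ∫ x in (0)..(2 * π), ‖f₂ s x‖ ≤ √D / δ * Real.exp (α * t) := by
    refine le_of_sq_le_sq ((h.sq_integral_norm_snd_le hα hs0).trans ?_) (by positivity)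
    calc 2 * π / α * circleJacobian f₁ f₂ s
        ≤ 2 * π / α * (B * Real.exp (2 * α) * Real.exp (α * t) ^ 2 / δ) := by gcongr
      _ = D / δ * Real.exp (α * t) ^ 2 := by rw [hD]; ring
      _ ≤ D / δ ^ 2 * Real.exp (α * t) ^ 2 := by
          gcongr
          exact pow_le_of_le_one hδ.le hδ1 two_ne_zero
      _ = (√D / δ * Real.exp (α * t)) ^ 2 := by rw [mul_pow, div_pow, Real.sq_sqrt hD0.le]
  have hm : ‖circleMean f s - l‖ ≤ C₁ * Real.exp α / δ * Real.exp (α * t) := by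
    refine (hl s (by linarith)).trans ?_
    have h3 : Real.exp (α * s) ≤ Real.exp α * Real.exp (α * t) := by
      rw [← Real.exp_add]
      apply Real.exp_le_exp.2
      nlinarith
    calc C₁ * Real.exp (α * s) ≤ C₁ * (Real.exp α * Real.exp (α * t)) := by gcongr
      _ = C₁ * Real.exp α * Real.exp (α * t) := by ring
      _ ≤ C₁ * Real.exp α / δ * Real.exp (α * t) := by
          gcongr
          exact le_div_self (by positivity) hδ hδ1
  calc ‖f s θ - l‖ = ‖(f s θ - circleMean f s) + (circleMean f s - l)‖ := by
        rw [sub_add_sub_cancel]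
    _ ≤ √D / δ * Real.exp (α * t) + C₁ * Real.exp α / δ * Real.exp (α * t) :=
        (norm_add_le _ _).trans (add_le_add ((h.norm_sub_circleMean_le hs0 θ).trans hL) hm)
    _ = _ := by ring

end IsQuasiregularOnCylinder

/-! ### Quasiregular maps of plane domains -/

/-- The map `W` is `C¹` and quasiregular on the open set `U`, the dilatation being encoded by the
domination of the squared norm of each directional derivative by `α⁻¹` times the Jacobian. In this
form, invariance under composition with holomorphic maps is immediate. -/
structure IsQuasiregularOn (α : ℝ) (W : ℂ → ℂ) (U : Set ℂ) : Prop where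
  contDiffOn : ContDiffOn ℝ 1 W U
  sq_norm_le : ∀ z ∈ U, ∀ v, α * ‖fderiv ℝ W z v‖ ^ 2
    ≤ wedge (fderiv ℝ W z v) (fderiv ℝ W z (Complex.I * v))

namespace IsQuasiregularOn

variable {α : ℝ} {W : ℂ → ℂ} {U : Set ℂ}

theorem mono (h : IsQuasiregularOn α W U) {V : Set ℂ} (hV : V ⊆ U) : IsQuasiregularOn α W V :=
  ⟨h.contDiffOn.mono hV, fun z hz => h.sq_norm_le z (hV hz)⟩

theorem sub_const (h : IsQuasiregularOn α W U) (c : ℂ) :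
    IsQuasiregularOn α (fun z => W z - c) U :=
  ⟨h.contDiffOn.sub contDiffOn_const, fun z hz v => by
    simpa only [fderiv_sub_const] using h.sq_norm_le z hz v⟩

/-- Precomposition with a periodic holomorphic map `g` transplants `W` to the half-cylinder. -/
theorem comp_holomorphic (h : IsQuasiregularOn α W U) (hU : IsOpen U) {M : ℝ} (hM : 0 < M)
    (hW : ∀ z ∈ U, ‖W z‖ ≤ M) {g g' : ℂ → ℂ} (hg : ∀ ζ, HasDerivAt g (g' ζ) ζ)
    (hg' : Continuous g') (hgU : ∀ ζ : ℂ, ζ.re < 0 → g ζ ∈ U)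
    (hper : ∀ ζ, g (ζ + 2 * π * Complex.I) = g ζ) :
    IsQuasiregularOnCylinder α (fun t θ => M⁻¹ • W (g (t + θ * Complex.I)))
      (fun t θ => M⁻¹ • fderiv ℝ W (g (t + θ * Complex.I)) (g' (t + θ * Complex.I)))
      (fun t θ => M⁻¹ • fderiv ℝ W (g (t + θ * Complex.I))
        (Complex.I * g' (t + θ * Complex.I))) := by
  have hmem : ∀ t : ℝ, t < 0 → ∀ θ : ℝ, g (t + θ * Complex.I) ∈ U := fun t ht θ =>
    hgU _ (by simpa using ht)
  have hd : ∀ z ∈ U, HasFDerivAt W (fderiv ℝ W z) z := fun z hz =>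
    ((h.contDiffOn.contDiffAt (hU.mem_nhds hz)).differentiableAt one_ne_zero).hasFDerivAt
  have hgc : Continuous g := continuous_iff_continuousAt.2 fun x => (hg x).continuousAt
  have hζ : Continuous fun p : ℝ × ℝ => (p.1 + p.2 * Complex.I : ℂ) := by fun_prop
  have hDc : ContinuousOn (fun p : ℝ × ℝ => fderiv ℝ W (g (p.1 + p.2 * Complex.I)))
      (Iio 0 ×ˢ univ) :=
    (h.contDiffOn.continuousOn_fderiv_of_isOpen hU le_rfl).comp (hgc.comp hζ).continuousOn
      fun p hp => hmem p.1 hp.1 p.2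
  have hsq : ∀ (z : ℂ) , z ∈ U → ∀ v, α * ‖M⁻¹ • fderiv ℝ W z v‖ ^ 2
      ≤ wedge (M⁻¹ • fderiv ℝ W z v) (M⁻¹ • fderiv ℝ W z (Complex.I * v)) := by
    intro z hz v
    have := mul_le_mul_of_nonneg_left (h.sq_norm_le z hz v) (sq_nonneg M⁻¹)
    rw [wedge_smul_left, wedge_smul_right, norm_smul, Real.norm_eq_abs, mul_pow, sq_abs]
    linarith
  refine ⟨?_, ?_, ?_, ?_, ?_, ?_, ?_, ?_⟩
  · intro t ht θ
    have e1 : HasDerivAt (fun s : ℝ => g ((s : ℂ) + θ * Complex.I)) (g' (t + θ * Complex.I)) t := by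
      have := (hg (t + θ * Complex.I)).comp_add_const (t : ℂ) (θ * Complex.I)
      exact this.comp_ofReal
    exact ((hd _ (hmem t ht θ)).comp_hasDerivAt t e1).const_smul M⁻¹
  · intro t ht θ
    have e0 : HasDerivAt (fun s : ℝ => (t : ℂ) + (s : ℂ) * Complex.I) Complex.I θ := by
      simpa using ((hasDerivAt_id θ).ofReal_comp.mul_const Complex.I).const_add (t : ℂ)
    have e1 : HasDerivAt (fun s : ℝ => g (t + (s : ℂ) * Complex.I))
        (Complex.I * g' (t + θ * Complex.I)) θ := by
      rw [mul_comm]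
      exact (hg (t + θ * Complex.I)).comp θ e0
    exact ((hd _ (hmem t ht θ)).comp_hasDerivAt θ e1).const_smul M⁻¹
  · exact (hDc.clm_apply (hg'.comp hζ).continuousOn).const_smul M⁻¹
  · exact (hDc.clm_apply (continuous_const.mul (hg'.comp hζ)).continuousOn).const_smul M⁻¹
  · intro t ht θ
    have : ((t : ℂ) + ((θ + 2 * π : ℝ) : ℂ) * Complex.I)
        = (t + θ * Complex.I) + 2 * π * Complex.I := by push_cast; ring
    simp only [this, hper]
  · intro t ht θ
    rw [norm_smul, norm_inv, Real.norm_eq_abs, abs_of_pos hM, inv_mul_le_iff₀ hM, mul_one]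
    exact hW _ (hmem t ht θ)
  · exact fun t ht θ => hsq _ (hmem t ht θ) _
  · intro t ht θ
    have h1 := hsq _ (hmem t ht θ) (Complex.I * g' (t + θ * Complex.I))
    have h2 : Complex.I * (Complex.I * g' (t + θ * Complex.I)) = -g' (t + θ * Complex.I) := by
      rw [← mul_assoc, Complex.I_mul_I, neg_one_mul]
    rw [h2, map_neg] at h1
    refine h1.trans (le_of_eq ?_)
    simp only [wedge, smul_neg, Complex.neg_im, Complex.neg_re]; ring

/-- In a half-cylinder parametrisation of a punctured neighbourhood of a point or of infinity, `W` is
close to a limit value on suitable circles. -/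
theorem exists_circle_near_limit (hα : 0 < α) :
    ∃ C > 0, ∀ (W : ℂ → ℂ) (U : Set ℂ) (M : ℝ) (g g' : ℂ → ℂ), IsQuasiregularOn α W U →
      IsOpen U → 0 < M → (∀ z ∈ U, ‖W z‖ ≤ M) → (∀ ζ, HasDerivAt g (g' ζ) ζ) → Continuous g' →
      (∀ ζ : ℂ, ζ.re < 0 → g ζ ∈ U) → (∀ ζ, g (ζ + 2 * π * Complex.I) = g ζ) →
      ∃ l : ℂ, ∀ t : ℝ, t ≤ -2 → ∀ δ, 0 < δ → δ ≤ 1 → ∃ s ∈ Icc t (t + δ), ∀ θ : ℝ,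
        ‖W (g (s + θ * Complex.I)) - l‖ ≤ C / δ * M * Real.exp (α * t) := by
  obtain ⟨C, hC, H⟩ := IsQuasiregularOnCylinder.exists_circle_near_limit hα
  refine ⟨C, hC, fun W U M g g' hW hU hM hWM hg hg' hgU hper => ?_⟩
  obtain ⟨l, hl⟩ := H _ _ _ (hW.comp_holomorphic hU hM hWM hg hg' hgU hper)
  refine ⟨M • l, fun t ht δ hδ hδ1 => ?_⟩
  obtain ⟨s, hs, h⟩ := hl t ht δ hδ hδ1
  refine ⟨s, hs, fun θ => ?_⟩
  have h1 := h θ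
  have e : W (g (s + θ * Complex.I)) - M • l = M • (M⁻¹ • W (g (s + θ * Complex.I)) - l) := by
    rw [smul_sub, smul_inv_smul₀ hM.ne']
  rw [e, norm_smul, Real.norm_eq_abs, abs_of_pos hM]
  calc M * ‖M⁻¹ • W (g (s + θ * Complex.I)) - l‖ ≤ M * (C / δ * Real.exp (α * t)) := by gcongr
    _ = _ := by ring

/-- Circles about an interior point `x`; the limit value is `W x` by continuity. -/
theorem exists_circle_near_center (hα : 0 < α) :
    ∃ C > 0, ∀ (W : ℂ → ℂ) (x : ℂ) (d M : ℝ), 0 < d → 0 < M →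
      IsQuasiregularOn α W (Metric.ball x d) → (∀ z ∈ Metric.ball x d, ‖W z‖ ≤ M) →
      ∀ r, 0 < r → r ≤ d * Real.exp (-2) → ∀ δ, 0 < δ → δ ≤ 1 →
        ∃ ρ ∈ Icc r (Real.exp δ * r), ∀ z, ‖z - x‖ = ρ →
          ‖W z - W x‖ ≤ C / δ * M * (r / d) ^ α := by
  obtain ⟨C, hC, H⟩ := exists_circle_near_limit hα
  refine ⟨C, hC, fun W x d M hd hM hW hWM => ?_⟩
  have hnorm : ∀ ζ : ℂ, ‖(x + d * Complex.exp ζ) - x‖ = d * Real.exp ζ.re := fun ζ => by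
    rw [add_sub_cancel_left, norm_mul, Complex.norm_exp, Complex.norm_real, Real.norm_eq_abs,
      abs_of_pos hd]
  obtain ⟨l, hl⟩ := H W (Metric.ball x d) M (fun ζ => x + d * Complex.exp ζ)
    (fun ζ => d * Complex.exp ζ) hW Metric.isOpen_ball hM hWM
    (fun ζ => ((Complex.hasDerivAt_exp ζ).const_mul (d : ℂ)).const_add x)
    (by fun_prop)
    (fun ζ hζ => by
      rw [mem_ball_iff_norm, hnorm]
      have := Real.exp_lt_one_iff.2 hζ
      nlinarith)
    (fun ζ => by rw [Complex.exp_periodic])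
  have hlx : l = W x := by
    have hWx : ContinuousAt W x :=
      hW.contDiffOn.continuousOn.continuousAt (Metric.ball_mem_nhds x hd)
    have hbot : ∀ k : ℕ, -((k : ℝ) + 2) ≤ -2 := fun k => by
      have := k.cast_nonneg (α := ℝ); linarith
    choose s hs hs' using fun k : ℕ => hl (-((k : ℝ) + 2)) (hbot k) 1 one_pos le_rfl
    have htop : Tendsto (fun k : ℕ => (k : ℝ) + 2) atTop atTop :=
      tendsto_atTop_add_const_right _ _ tendsto_natCast_atTop_atTop
    have hsbot : Tendsto s atTop atBot := by
      refine tendsto_atBot_mono (fun k => (hs k).2) ?_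
      exact tendsto_atBot_add_const_right _ _ (tendsto_neg_atTop_atBot.comp htop)
    have h1 : Tendsto (fun k => x + d * Complex.exp (s k + (0 : ℝ) * Complex.I)) atTop (𝓝 x) := by
      rw [tendsto_iff_norm_sub_tendsto_zero]
      simp only [hnorm]
      have := (Real.tendsto_exp_atBot.comp hsbot).const_mul d
      simpa using this
    have h2 := hWx.tendsto.comp h1
    have h3 : Tendsto (fun k : ℕ => C / 1 * M * Real.exp (α * -((k : ℝ) + 2))) atTop (𝓝 0) := by
      rw [← mul_zero (C / 1 * M)]
      refine Tendsto.const_mul _ (Real.tendsto_exp_atBot.comp ?_)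
      exact Tendsto.const_mul_atBot hα (tendsto_neg_atTop_atBot.comp htop)
    have h4 : Tendsto (fun k => W (x + d * Complex.exp (s k + (0 : ℝ) * Complex.I))) atTop (𝓝 l) :=
      tendsto_iff_norm_sub_tendsto_zero.2
        (squeeze_zero (fun _ => norm_nonneg _) (fun k => hs' k 0) h3)
    exact tendsto_nhds_unique h4 h2
  subst hlx
  intro r hr hrd δ hδ hδ1
  have hrd0 : 0 < r / d := by positivity
  have hexp : d * Real.exp (Real.log (r / d)) = r := by rw [Real.exp_log hrd0]; field_simp
  obtain ⟨s, hs, h⟩ := hl (Real.log (r / d)) (by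
    rw [Real.log_le_iff_le_exp hrd0, div_le_iff₀ hd]; linarith) δ hδ hδ1
  refine ⟨d * Real.exp s, ⟨?_, ?_⟩, fun z hz => ?_⟩
  · rw [← hexp]; gcongr; exact hs.1
  · calc d * Real.exp s ≤ d * Real.exp (Real.log (r / d) + δ) := by gcongr; exact hs.2
      _ = Real.exp δ * (d * Real.exp (Real.log (r / d))) := by rw [Real.exp_add]; ring
      _ = _ := by rw [hexp]
  · have hz' : x + d * Complex.exp (s + (Complex.arg (z - x) : ℝ) * Complex.I) = z := by
      rw [Complex.exp_add, ← mul_assoc, ← Complex.ofReal_exp, ← Complex.ofReal_mul, ← hz,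
        Complex.norm_mul_exp_arg_mul_I]
      ring
    have h1 := h (Complex.arg (z - x))
    rw [hz'] at h1
    rwa [Real.rpow_def_of_pos hrd0, mul_comm (Real.log _)]

/-- Circles about infinity. -/
theorem exists_circle_near_infinity (hα : 0 < α) :
    ∃ C > 0, ∀ (W : ℂ → ℂ) (R M : ℝ), 0 < R → 0 < M →
      IsQuasiregularOn α W {z | R < ‖z‖} → (∀ z, R < ‖z‖ → ‖W z‖ ≤ M) →
      ∃ l : ℂ, ∀ r, R * Real.exp 2 ≤ r → ∀ δ, 0 < δ → δ ≤ 1 →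
        ∃ ρ ∈ Icc (Real.exp (-δ) * r) r, ∀ z, ‖z‖ = ρ →
          ‖W z - l‖ ≤ C / δ * M * (R / r) ^ α := by
  obtain ⟨C, hC, H⟩ := exists_circle_near_limit hα
  refine ⟨C, hC, fun W R M hR hM hW hWM => ?_⟩
  obtain ⟨l, hl⟩ := H W {z | R < ‖z‖} M (fun ζ => R * Complex.exp (-ζ))
    (fun ζ => R * (Complex.exp (-ζ) * -1)) hW (isOpen_lt continuous_const continuous_norm) hM hWM
    (fun ζ => ((hasDerivAt_neg ζ).cexp).const_mul (R : ℂ))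
    (by fun_prop)
    (fun ζ hζ => by
      rw [mem_ofPred_eq, norm_mul, Complex.norm_exp, Complex.norm_real, Real.norm_eq_abs,
        abs_of_pos hR, Complex.neg_re]
      have : 1 < Real.exp (-ζ.re) := Real.one_lt_exp_iff.2 (by linarith)
      nlinarith)
    (fun ζ => by rw [neg_add, ← sub_eq_add_neg, Complex.exp_periodic.sub_eq])
  refine ⟨l, fun r hr δ hδ hδ1 => ?_⟩
  have hr0 : 0 < r := lt_of_lt_of_le (by positivity) hr
  have hrd0 : 0 < R / r := by positivity
  have hexp : R * Real.exp (-Real.log (R / r)) = r := by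
    rw [Real.exp_neg, Real.exp_log hrd0]; field_simp
  obtain ⟨s, hs, h⟩ := hl (Real.log (R / r)) (by
    rw [Real.log_le_iff_le_exp hrd0, div_le_iff₀ hr0, Real.exp_neg, inv_mul_eq_div,
      le_div_iff₀ (Real.exp_pos _)]; linarith) δ hδ hδ1
  refine ⟨R * Real.exp (-s), ⟨?_, ?_⟩, fun z hz => ?_⟩
  · calc Real.exp (-δ) * r = Real.exp (-δ) * (R * Real.exp (-Real.log (R / r))) := by rw [hexp]
      _ = R * Real.exp (-(Real.log (R / r) + δ)) := by rw [neg_add, Real.exp_add]; ring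
      _ ≤ R * Real.exp (-s) := by gcongr; exact hs.2
  · refine le_of_le_of_eq ?_ hexp; gcongr; exact hs.1
  · have hz' : R * Complex.exp (-(s + ((-Complex.arg z : ℝ) : ℂ) * Complex.I)) = z := by
      have : (-(s + ((-Complex.arg z : ℝ) : ℂ) * Complex.I) : ℂ)
          = ((-s : ℝ) : ℂ) + Complex.arg z * Complex.I := by push_cast; ring
      rw [this, Complex.exp_add, ← mul_assoc, ← Complex.ofReal_exp, ← Complex.ofReal_mul, ← hz,
        Complex.norm_mul_exp_arg_mul_I]
    have h1 := h (-Complex.arg z)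
    rw [hz'] at h1
    rwa [Real.rpow_def_of_pos hrd0, mul_comm (Real.log _)]

end IsQuasiregularOn

/-! ### Hölder continuity in the interior and decay at infinity -/

/-- Two circles whose centres have distance `r` and whose radii lie between `r` and `2r` intersect. -/
theorem exists_mem_inter_spheres {x y : ℂ} {r ρ₁ ρ₂ : ℝ} (hr : 0 < r) (hxy : ‖x - y‖ = r)
    (h₁ : ρ₁ ∈ Icc r (2 * r)) (h₂ : ρ₂ ∈ Icc r (2 * r)) :
    ∃ z, ‖z - x‖ = ρ₁ ∧ ‖z - y‖ = ρ₂ := by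
  set u : ℂ := (x - y) / r with hu
  have hr' : (r : ℂ) ≠ 0 := by exact_mod_cast hr.ne'
  have hxyu : x - y = r * u := by rw [hu]; field_simp
  have hu1 : ‖u‖ = 1 := by
    rw [hu, norm_div, hxy, Complex.norm_real, Real.norm_eq_abs, abs_of_pos hr, div_self hr.ne']
  have hρ1 : 0 < ρ₁ := hr.trans_le h₁.1
  let γ : ℝ → ℂ := fun θ => x + ρ₁ * Complex.exp (θ * Complex.I) * u
  have hγ : Continuous fun θ => ‖γ θ - y‖ := by fun_prop
  have h0 : ‖γ 0 - y‖ = ρ₁ + r := by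
    have : γ 0 - y = ((ρ₁ + r : ℝ) : ℂ) * u := by
      simp only [γ, Complex.ofReal_zero, zero_mul, Complex.exp_zero, mul_one]
      push_cast
      linear_combination hxyu
    rw [this, norm_mul, hu1, mul_one, Complex.norm_real, Real.norm_eq_abs, abs_of_pos (by linarith)]
  have hπ : ‖γ π - y‖ = ρ₁ - r := by
    have : γ π - y = ((r - ρ₁ : ℝ) : ℂ) * u := by
      simp only [γ, Complex.exp_pi_mul_I]
      push_cast
      linear_combination hxyu
    rw [this, norm_mul, hu1, mul_one, Complex.norm_real, Real.norm_eq_abs, abs_sub_comm,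
      abs_of_nonneg (by have := h₁.1; linarith)]
  obtain ⟨θ, -, hθ⟩ := intermediate_value_Icc' Real.pi_pos.le hγ.continuousOn
    (show ρ₂ ∈ Icc (‖γ π - y‖) (‖γ 0 - y‖) by
      rw [h0, hπ]; constructor <;> linarith [h₁.1, h₁.2, h₂.1, h₂.2])
  refine ⟨γ θ, ?_, hθ⟩
  simp only [γ, add_sub_cancel_left]
  rw [norm_mul, norm_mul, hu1, Complex.norm_exp_ofReal_mul_I, Complex.norm_real, Real.norm_eq_abs,
    abs_of_pos hρ1, mul_one, mul_one]

theorem le_rpow_of_le_one {α x : ℝ} (hα1 : α ≤ 1) (hx : 0 < x) (hx1 : x ≤ 1) : x ≤ x ^ α := by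
  simpa using Real.rpow_le_rpow_of_exponent_ge hx hx1 hα1

theorem rpow_two_mul_le {α x : ℝ} (hα1 : α ≤ 1) (hx : 0 ≤ x) : (2 * x) ^ α ≤ 2 * x ^ α := by
  rw [Real.mul_rpow (by norm_num) hx]
  gcongr
  simpa using Real.rpow_le_rpow_of_exponent_le (by norm_num : (1 : ℝ) ≤ 2) hα1

namespace IsQuasiregularOn

variable {α : ℝ}

/-- The interior Hölder estimate: good circles about the two points have a common point. -/
theorem exists_holder_const (hα : 0 < α) (hα1 : α ≤ 1) :
    ∃ C > 0, ∀ (W : ℂ → ℂ) (x : ℂ) (d M : ℝ), 0 < d → 0 < M →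
      IsQuasiregularOn α W (Metric.ball x d) → (∀ z ∈ Metric.ball x d, ‖W z‖ ≤ M) →
      ∀ y ∈ Metric.ball x d, ‖W x - W y‖ ≤ C * M * (‖x - y‖ / d) ^ α := by
  obtain ⟨C, hC, H⟩ := exists_circle_near_center hα
  refine ⟨8 * C + 4 * Real.exp 2, by positivity, fun W x d M hd hM hW hWM y hy => ?_⟩
  rcases eq_or_ne x y with rfl | hne
  · simp [hα.ne']
  set r := ‖x - y‖ with hr
  have hr0 : 0 < r := norm_pos_iff.2 (sub_ne_zero.2 hne)
  have hrd : r < d := by rwa [mem_ball_iff_norm, norm_sub_rev] at hy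
  have hX0 : 0 ≤ (r / d) ^ α := by positivity
  rcases le_total r (d / 2 * Real.exp (-2)) with hsmall | hbig
  · have hexp2 : Real.exp (-2) ≤ 1 := by simp
    have hrd2 : r ≤ d / 2 := by nlinarith
    have hx : Metric.ball x (d / 2) ⊆ Metric.ball x d := Metric.ball_subset_ball (by linarith)
    have hy' : Metric.ball y (d / 2) ⊆ Metric.ball x d := by
      refine Metric.ball_subset_ball' ?_
      rw [dist_comm, dist_eq_norm]; linarith
    have hsqrt : Real.exp (1 / 2) ≤ 2 := by
      have h1 : Real.exp (1 / 2) * Real.exp (1 / 2) = Real.exp 1 := by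
        rw [← Real.exp_add]; norm_num
      nlinarith [Real.exp_one_lt_d9, Real.exp_pos (1 / 2)]
    obtain ⟨ρ₁, hρ₁, h₁⟩ := H W x (d / 2) M (by positivity) hM (hW.mono hx)
      (fun z hz => hWM z (hx hz)) r hr0 hsmall (1 / 2) (by norm_num) (by norm_num)
    obtain ⟨ρ₂, hρ₂, h₂⟩ := H W y (d / 2) M (by positivity) hM (hW.mono hy')
      (fun z hz => hWM z (hy' hz)) r hr0 hsmall (1 / 2) (by norm_num) (by norm_num)
    have hsub : Icc r (Real.exp (1 / 2) * r) ⊆ Icc r (2 * r) := Icc_subset_Icc_right (by gcongr)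
    obtain ⟨z, hzx, hzy⟩ := exists_mem_inter_spheres hr0 hr.symm (hsub hρ₁) (hsub hρ₂)
    have e : r / (d / 2) = 2 * (r / d) := by ring
    have hdouble : (r / (d / 2)) ^ α ≤ 2 * (r / d) ^ α := by
      rw [e]; exact rpow_two_mul_le hα1 (by positivity)
    have h3 : C / (1 / 2) * M * (r / (d / 2)) ^ α ≤ C / (1 / 2) * M * (2 * (r / d) ^ α) := by
      gcongr
    have h4 := h₁ z hzx
    have h5 := h₂ z hzy
    calc ‖W x - W y‖ = ‖(W z - W y) - (W z - W x)‖ := by rw [sub_sub_sub_cancel_left]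
      _ ≤ ‖W z - W y‖ + ‖W z - W x‖ := norm_sub_le _ _
      _ ≤ 2 * (C / (1 / 2) * M * (2 * (r / d) ^ α)) := by linarith
      _ = 8 * C * M * (r / d) ^ α := by ring
      _ ≤ (8 * C + 4 * Real.exp 2) * M * (r / d) ^ α := by
          gcongr
          linarith [Real.exp_pos 2]
  · have h1 : r / d ≤ (r / d) ^ α :=
      le_rpow_of_le_one hα1 (by positivity) ((div_le_one hd).2 hrd.le)
    have h2 : 1 ≤ 2 * Real.exp 2 * (r / d) := by
      rw [Real.exp_neg, ← div_eq_mul_inv, div_le_iff₀ (Real.exp_pos _)] at hbig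
      rw [← mul_div_assoc, le_div_iff₀ hd]
      linarith
    calc ‖W x - W y‖ ≤ ‖W x‖ + ‖W y‖ := norm_sub_le _ _
      _ ≤ M + M := add_le_add (hWM x (Metric.mem_ball_self hd)) (hWM y hy)
      _ = 2 * M * 1 := by ring
      _ ≤ 2 * M * (2 * Real.exp 2 * (r / d) ^ α) := by
          gcongr
          refine h2.trans ?_
          gcongr
      _ = 4 * Real.exp 2 * M * (r / d) ^ α := by ring
      _ ≤ (8 * C + 4 * Real.exp 2) * M * (r / d) ^ α := by
          gcongr
          linarith

/-- Decay at infinity. On good circles about infinity `W` is as close to its limit `l` as claimed. A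
point `z` has a good circle within distance `δ ‖z‖`, so the interior Hölder estimate on the disc of
radius `‖z‖ / 2` about `z` bounds `W z - l` by the claimed quantity plus a quarter of the supremum of
`W - l` on that disc. Iteration over dyadic scales removes the second term. -/
theorem exists_decay_const (hα : 0 < α) (hα1 : α ≤ 1) :
    ∃ C > 0, ∀ (W : ℂ → ℂ) (R M : ℝ), 0 < R → 0 < M →
      IsQuasiregularOn α W {z | R < ‖z‖} → (∀ z, R < ‖z‖ → ‖W z‖ ≤ M) →
      ∃ l : ℂ, ∀ z, R < ‖z‖ → ‖W z - l‖ ≤ C * M * (R / ‖z‖) ^ α := by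
  obtain ⟨C₁, hC₁, H₁⟩ := exists_circle_near_infinity hα
  obtain ⟨C₂, hC₂, H₂⟩ := exists_holder_const hα hα1
  -- `δ` is chosen such that `C₂ * (2 * δ) ^ α ≤ 1 / 4`
  set δ : ℝ := (1 / (4 * (C₂ + 1))) ^ α⁻¹ / 2 with hδdef
  have hbase0 : 0 < 1 / (4 * (C₂ + 1)) := by positivity
  have hbase1 : 1 / (4 * (C₂ + 1)) < 1 := by
    rw [div_lt_one (by positivity)]; linarith
  have hδ0 : 0 < δ := by positivity
  have hδ1 : δ < 1 / 2 := by
    have := Real.rpow_lt_one hbase0.le hbase1 (inv_pos.2 hα)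
    rw [hδdef]; linarith
  have hδα : C₂ * (2 * δ) ^ α ≤ 1 / 4 := by
    have : 2 * δ = (1 / (4 * (C₂ + 1))) ^ α⁻¹ := by rw [hδdef]; ring
    rw [this, Real.rpow_inv_rpow hbase0.le hα.ne', mul_one_div, div_le_div_iff₀ (by positivity)
      (by norm_num)]
    linarith
  set A := C₁ / δ with hA
  have hA0 : 0 < A := by positivity
  refine ⟨2 * A + 16 * (2 + A), by positivity, fun W R M hR hM hW hWM => ?_⟩
  obtain ⟨l, hl⟩ := H₁ W R M hR hM hW hWM
  refine ⟨l, ?_⟩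
  have hcirc : ∀ r, R * Real.exp 2 ≤ r → ∃ ρ ∈ Icc ((1 - δ) * r) r, ∀ z, ‖z‖ = ρ →
      ‖W z - l‖ ≤ A * M * (R / r) ^ α := by
    intro r hr
    have hr0 : 0 < r := lt_of_lt_of_le (by positivity) hr
    obtain ⟨ρ, hρ, h⟩ := hl r hr δ hδ0 (by linarith)
    refine ⟨ρ, ⟨le_trans ?_ hρ.1, hρ.2⟩, h⟩
    have := Real.one_sub_le_exp_neg δ
    gcongr
  have hexp : Real.exp 2 < 8 := by
    have h1 : Real.exp 2 = Real.exp 1 * Real.exp 1 := by rw [← Real.exp_add]; norm_num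
    nlinarith [Real.exp_one_lt_d9, Real.exp_pos 1]
  have hexp1 : 2 < Real.exp 2 := by
    have := Real.add_one_lt_exp (two_ne_zero (α := ℝ)); linarith
  set N := (2 + A) * M with hN
  have hN0 : 0 < N := by positivity
  have hlM : ‖l‖ ≤ (1 + A) * M := by
    obtain ⟨ρ, hρ, h⟩ := hcirc (R * Real.exp 2) le_rfl
    have hρR : R < ρ := by
      refine lt_of_lt_of_le ?_ hρ.1
      nlinarith [mul_pos hR (sub_pos.2 hexp1)]
    have hnρ : ‖(ρ : ℂ)‖ = ρ := by
      rw [Complex.norm_real, Real.norm_eq_abs, abs_of_pos (hR.trans hρR)]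
    have h1 := h ρ hnρ
    have h2 := hWM ρ (by rwa [hnρ])
    have h3 : (R / (R * Real.exp 2)) ^ α ≤ 1 := by
      refine Real.rpow_le_one (by positivity) ?_ hα.le
      rw [div_le_one (by positivity)]
      nlinarith
    have h4 : A * M * (R / (R * Real.exp 2)) ^ α ≤ A * M := mul_le_of_le_one_right (by positivity) h3
    have h5 := norm_sub_le (W ρ) (W ρ - l)
    rw [sub_sub_cancel] at h5
    linarith
  have huN : ∀ z, R < ‖z‖ → ‖W z - l‖ ≤ N := fun z hz =>
    (norm_sub_le _ _).trans (by have := hWM z hz; rw [hN]; linarith)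
  have hiter : ∀ k : ℕ, ∀ z, 8 * R * 2 ^ k ≤ ‖z‖ →
      ‖W z - l‖ ≤ 2 * A * M * (R / ‖z‖) ^ α + N / 4 ^ k := by
    intro k
    induction k with
    | zero =>
      intro z hz
      rw [pow_zero, mul_one] at hz
      have h1 := huN z (by linarith)
      have h2 : 0 ≤ 2 * A * M * (R / ‖z‖) ^ α := by positivity
      rw [pow_zero, div_one]
      linarith
    | succ k ih =>
      intro z hz
      set r := ‖z‖ with hr
      have hk : (1 : ℝ) ≤ 2 ^ k := one_le_pow₀ (by norm_num)
      have hz' : 8 * R * 2 ^ k ≤ r / 2 := by rw [pow_succ] at hz; linarith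
      have h8 : 8 * R ≤ 8 * R * 2 ^ k := le_mul_of_one_le_right (by positivity) hk
      have hr0 : 0 < r := by linarith
      set X := (R / r) ^ α with hX
      have hX0 : 0 ≤ X := by positivity
      set m := 2 * A * M * (2 * X) + N / 4 ^ k with hm
      have hm0 : 0 < m := by positivity
      have hball : ∀ y ∈ Metric.ball z (r / 2), r / 2 ≤ ‖y‖ := by
        intro y hy
        rw [mem_ball_iff_norm, norm_sub_rev] at hy
        have := norm_sub_norm_le z y
        linarith
      have hbound : ∀ y ∈ Metric.ball z (r / 2), ‖W y - l‖ ≤ m := by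
        intro y hy
        have hy' := hball y hy
        refine (ih y (hz'.trans hy')).trans ?_
        rw [hm, hX]
        gcongr
        refine le_trans ?_ (rpow_two_mul_le hα1 (by positivity))
        gcongr
        rw [div_le_iff₀ (by linarith)]
        have e : 2 * (R / r) * (r / 2) = R := by field_simp
        nlinarith [mul_le_mul_of_nonneg_left hy' (by positivity : 0 ≤ 2 * (R / r))]
      have hqr : IsQuasiregularOn α (fun y => W y - l) (Metric.ball z (r / 2)) :=
        (hW.mono fun y hy => by
          have := hball y hy
          rw [mem_ofPred_eq]; linarith).sub_const l
      obtain ⟨ρ, hρ, hcl⟩ := hcirc r (by nlinarith)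
      have hρ0 : 0 < ρ := lt_of_lt_of_le (mul_pos (by linarith) hr0) hρ.1
      set y : ℂ := ((ρ / r : ℝ) : ℂ) * z with hy
      have hyn : ‖y‖ = ρ := by
        rw [hy, norm_mul, Complex.norm_real, Real.norm_eq_abs, abs_of_pos (by positivity), ← hr]
        field_simp
      have hzy : ‖z - y‖ ≤ δ * r := by
        have e : z - y = ((1 - ρ / r : ℝ) : ℂ) * z := by rw [hy]; push_cast; ring
        have h1 : ρ / r ≤ 1 := (div_le_one hr0).2 hρ.2
        rw [e, norm_mul, Complex.norm_real, Real.norm_eq_abs, abs_of_nonneg (by linarith), ← hr]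
        have h2 : (1 - ρ / r) * r = r - ρ := by field_simp
        rw [h2]
        linarith [hρ.1]
      have hyball : y ∈ Metric.ball z (r / 2) := by
        rw [mem_ball_iff_norm, norm_sub_rev]
        nlinarith
      have h1 := H₂ _ z (r / 2) m (by positivity) hm0 hqr hbound y hyball
      have h2 : C₂ * m * (‖z - y‖ / (r / 2)) ^ α ≤ m * (1 / 4) := by
        have : ‖z - y‖ / (r / 2) ≤ 2 * δ := by
          rw [div_le_iff₀ (by positivity)]; linarith
        calc C₂ * m * (‖z - y‖ / (r / 2)) ^ α ≤ C₂ * m * (2 * δ) ^ α := by gcongr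
          _ = m * (C₂ * (2 * δ) ^ α) := by ring
          _ ≤ m * (1 / 4) := by gcongr
      have h3 := hcl y hyn
      have h4 : ‖W z - l‖ ≤ ‖W z - l - (W y - l)‖ + ‖W y - l‖ := by
        simpa using norm_add_le (W z - l - (W y - l)) (W y - l)
      have h5 : N / 4 ^ (k + 1) = N / 4 ^ k * (1 / 4) := by rw [pow_succ]; field_simp
      rw [h5]
      have h6 : m * (1 / 4) = A * M * X + N / 4 ^ k * (1 / 4) := by rw [hm]; ring
      linarith
  intro z hz
  set r := ‖z‖ with hr
  have hr0 : 0 < r := hR.trans hz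
  have hX : R / r ≤ (R / r) ^ α :=
    le_rpow_of_le_one hα1 (by positivity) ((div_le_one hr0).2 hz.le)
  set X := (R / r) ^ α with hXdef
  have hX0 : 0 < X := by positivity
  have hNX : ∀ c, c ≤ 16 * (R / r) → N * c ≤ 16 * (2 + A) * M * X := fun c hc => by
    calc N * c ≤ N * (16 * X) := by gcongr; linarith
      _ = _ := by rw [hN]; ring
  have hsplit : (2 * A + 16 * (2 + A)) * M * X = 2 * A * M * X + 16 * (2 + A) * M * X := by ring
  have hAMX : 0 < 2 * A * M * X := by positivity
  rw [hsplit]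
  rcases lt_or_ge r (8 * R) with hlt | hge
  · have h1 := hNX 1 (by rw [← mul_div_assoc, le_div_iff₀ hr0]; linarith)
    have h2 := huN z hz
    linarith
  · obtain ⟨k, hk1, hk2⟩ := exists_nat_pow_near (x := r / (8 * R)) (y := 2)
      ((one_le_div (by positivity)).2 hge) (by norm_num)
    rw [le_div_iff₀ (by positivity)] at hk1
    rw [div_lt_iff₀ (by positivity)] at hk2
    have h1 := hiter k z (by linarith)
    have h2 := hNX (1 / 4 ^ k) (by
      have h24 : (2 : ℝ) ^ k ≤ 4 ^ k := by gcongr; norm_num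
      calc (1 : ℝ) / 4 ^ k ≤ 1 / 2 ^ k := by gcongr
        _ ≤ 16 * (R / r) := by
          rw [← mul_div_assoc, div_le_div_iff₀ (by positivity) hr0]
          rw [pow_succ] at hk2
          linarith)
    rw [mul_one_div] at h2
    linarith

end IsQuasiregularOn

/-! ### Exterior quasiconformal maps in complex notation -/

theorem qcExponent_pos {K : ℝ} (hK : 1 ≤ K) : 0 < qcExponent K := by
  unfold qcExponent
  rw [sub_pos, Real.sqrt_lt' (by linarith)]
  linarith

theorem qcExponent_le_one {K : ℝ} (hK : 1 ≤ K) : qcExponent K ≤ 1 := by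
  unfold qcExponent
  have : K - 1 ≤ √(K ^ 2 - 1) := Real.le_sqrt_of_sq_le (by nlinarith)
  linarith

/-- If `X` and `Y` are the squared lengths of the images of two orthogonal unit vectors and `D` is the
Jacobian, then `X + Y ≤ 2 K D` confines `X` to the interval between the roots of
`X² - 2 K D X + D² = 0`, the larger of which is `D / α`. -/
theorem qcExponent_mul_le {K X Y D : ℝ} (hK : 1 ≤ K) (hX : 0 ≤ X) (hY : 0 ≤ Y)
    (hXY : X + Y ≤ 2 * K * D) (hD : D ^ 2 ≤ X * Y) : qcExponent K * X ≤ D := by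
  have hD0 : 0 ≤ D := by
    by_contra! h
    nlinarith
  have hS : √(K ^ 2 - 1) ^ 2 = K ^ 2 - 1 := Real.sq_sqrt (by nlinarith)
  have hS0 := Real.sqrt_nonneg (K ^ 2 - 1)
  have hα := qcExponent_pos hK
  unfold qcExponent at hα ⊢
  set S := √(K ^ 2 - 1)
  have hq : (X - K * D) ^ 2 ≤ (S * D) ^ 2 := by
    rw [mul_pow, hS]
    nlinarith [mul_le_mul_of_nonneg_left hXY hX]
  have h1 := (abs_le_of_sq_le_sq' hq (by positivity)).2
  calc (K - S) * X ≤ (K - S) * ((K + S) * D) := by gcongr; linarith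
    _ = (K ^ 2 - S ^ 2) * D := by ring
    _ = D := by rw [hS]; ring

/-- The isometric identification of the complex plane with the Euclidean plane. -/
noncomputable def planeEquiv : ℂ ≃ₗᵢ[ℝ] Plane := Complex.orthonormalBasisOneI.repr

theorem planeEquiv_eq (v : ℂ) :
    planeEquiv v = v.re • EuclideanSpace.single 0 1 + v.im • EuclideanSpace.single 1 1 := by
  ext i
  fin_cases i <;> simp [planeEquiv]

/-- The map `w` of the plane in complex notation, `p + i q` as a function of `x₁ + i x₂`. -/
noncomputable def toComplex (w : Plane → Plane) (z : ℂ) : ℂ :=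
  planeEquiv.symm (w (planeEquiv z))

theorem toComplex_symm (w : Plane → Plane) (x : Plane) :
    toComplex w (planeEquiv.symm x) = planeEquiv.symm (w x) := by simp [toComplex]

theorem toComplex_eq (w : Plane → Plane) (z : ℂ) :
    toComplex w z = w (planeEquiv z) 0 + w (planeEquiv z) 1 * Complex.I :=
  Complex.orthonormalBasisOneI_repr_symm_apply _

theorem norm_toComplex (w : Plane → Plane) (z : ℂ) : ‖toComplex w z‖ = ‖w (planeEquiv z)‖ := by
  simp [toComplex]

theorem isQuasiregularOn_toComplex {K : ℝ} (hK : 1 ≤ K) {Ω : Set Plane} {w : Plane → Plane}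
    (hw : IsExteriorQuasiconformal K Ω w) :
    IsQuasiregularOn (qcExponent K) (toComplex w) (planeEquiv ⁻¹' (closure Ω)ᶜ) := by
  have hΩ : IsOpen (closure Ω)ᶜ := isClosed_closure.isOpen_compl
  have hfun : toComplex w
      = fun z => Complex.ofRealCLM (w (planeEquiv z) 0)
        + Complex.ofRealCLM (w (planeEquiv z) 1) * Complex.I := by
    ext z; simp [toComplex_eq]
  refine ⟨?_, fun z hz v => ?_⟩
  · have hp := hw.contDiffOn_fst.comp (planeEquiv.contDiff (n := 1)).contDiffOn
      (mapsTo_preimage _ _)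
    have hq := hw.contDiffOn_snd.comp (planeEquiv.contDiff (n := 1)).contDiffOn
      (mapsTo_preimage _ _)
    rw [hfun]
    exact (Complex.ofRealCLM.contDiff.comp_contDiffOn hp).add
      ((Complex.ofRealCLM.contDiff.comp_contDiffOn hq).mul contDiffOn_const)
  · have hL : HasFDerivAt planeEquiv (planeEquiv.toContinuousLinearEquiv : ℂ →L[ℝ] Plane) z :=
      planeEquiv.toContinuousLinearEquiv.hasFDerivAt
    have hp : HasFDerivAt (fun x => w x 0) (fderiv ℝ (fun x => w x 0) (planeEquiv z))
        (planeEquiv z) :=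
      ((hw.contDiffOn_fst.contDiffAt (hΩ.mem_nhds hz)).differentiableAt one_ne_zero).hasFDerivAt
    have hq : HasFDerivAt (fun x => w x 1) (fderiv ℝ (fun x => w x 1) (planeEquiv z))
        (planeEquiv z) :=
      ((hw.contDiffOn_snd.contDiffAt (hΩ.mem_nhds hz)).differentiableAt one_ne_zero).hasFDerivAt
    have hW := ((Complex.ofRealCLM.hasFDerivAt.comp z (hp.comp z hL)).add
      ((Complex.ofRealCLM.hasFDerivAt.comp z (hq.comp z hL)).mul_const Complex.I)).fderiv
    change fderiv ℝ (fun z => Complex.ofRealCLM (w (planeEquiv z) 0)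
        + Complex.ofRealCLM (w (planeEquiv z) 1) * Complex.I) z = _ at hW
    rw [← hfun] at hW
    have hdil := hw.dilatation_le (planeEquiv z) hz
    have hval : ∀ u : ℂ, fderiv ℝ (toComplex w) z u
        = ((u.re * partialDeriv (fun y => w y 0) 0 (planeEquiv z)
            + u.im * partialDeriv (fun y => w y 0) 1 (planeEquiv z) : ℝ) : ℂ)
          + ((u.re * partialDeriv (fun y => w y 1) 0 (planeEquiv z)
            + u.im * partialDeriv (fun y => w y 1) 1 (planeEquiv z) : ℝ) : ℂ) * Complex.I := by
      intro u
      rw [hW]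
      simp [planeEquiv_eq u, partialDeriv, mul_comm]
    rw [hval v, hval (Complex.I * v)]
    simp only [Complex.mul_re, Complex.mul_im, Complex.I_re, Complex.I_im, zero_mul, one_mul,
      zero_sub, zero_add]
    generalize partialDeriv (fun y => w y 0) 0 (planeEquiv z) = a at *
    generalize partialDeriv (fun y => w y 0) 1 (planeEquiv z) = b at *
    generalize partialDeriv (fun y => w y 1) 0 (planeEquiv z) = c at *
    generalize partialDeriv (fun y => w y 1) 1 (planeEquiv z) = e at *
    have hn : ∀ s t : ℝ, ‖(s : ℂ) + (t : ℂ) * Complex.I‖ ^ 2 = s ^ 2 + t ^ 2 := fun s t => by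
      rw [← Complex.normSq_eq_norm_sq, Complex.normSq_add_mul_I]
    have hwedge : ∀ s t s' t' : ℝ, wedge ((s : ℂ) + (t : ℂ) * Complex.I)
        ((s' : ℂ) + (t' : ℂ) * Complex.I) = s * t' - t * s' := fun s t s' t' => by
      simp [wedge]
    rw [hn, hwedge]
    have hdil' := mul_le_mul_of_nonneg_left hdil
      (by positivity : 0 ≤ v.re ^ 2 + v.im ^ 2)
    refine qcExponent_mul_le (Y := (-v.im * a + v.re * b) ^ 2 + (-v.im * c + v.re * e) ^ 2)
      hK (by positivity) (by positivity) ?_ ?_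
    · linarith
    · nlinarith [sq_nonneg ((v.re * a + v.im * b) * (-v.im * a + v.re * b)
        + (v.re * c + v.im * e) * (-v.im * c + v.re * e))]

/-- A segment from a point outside `Ω'` to a point of `Ω ⊆ Ω'` crosses the frontier of `Ω'`. -/
theorem ball_subset_compl_closure {Ω Ω' : Set Plane} {d : ℝ} (h : IsOuterNeighborhood Ω Ω' d)
    {x : Plane} (hx : x ∈ (closure Ω')ᶜ) : Metric.ball x d ⊆ (closure Ω)ᶜ := by
  have hdisj : Disjoint (Metric.ball x d) Ω := by
    rw [Set.disjoint_left]
    intro z hz hzΩ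
    obtain ⟨y, hy, hyf⟩ : ∃ y ∈ segment ℝ z x, y ∈ frontier Ω' := by
      by_contra! hno
      obtain ⟨y, -, hy1, hy2⟩ := (convex_segment z x).isPreconnected Ω' (closure Ω')ᶜ h.isOpen
        isClosed_closure.isOpen_compl
        (fun y hy => by
          by_contra hy'
          rw [mem_union, not_or, mem_compl_iff, not_not] at hy'
          exact hno y hy (h.isOpen.frontier_eq ▸ ⟨hy'.2, hy'.1⟩))
        ⟨z, left_mem_segment ℝ z x, h.closure_subset (subset_closure hzΩ)⟩
        ⟨x, right_mem_segment ℝ z x, hx⟩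
      exact hy2 (subset_closure hy1)
    have h1 : d ≤ dist z y := h.dist_frontier.1 ⟨z, hzΩ, y, hyf, rfl⟩
    have h2 := dist_add_dist_of_mem_segment hy
    rw [Metric.mem_ball] at hz
    have h3 := dist_nonneg (x := y) (y := x)
    linarith
  exact fun z hz hzc => (hdisj.closure_right Metric.isOpen_ball).le_bot ⟨hz, hzc⟩

end ExteriorQuasiconformal

open ExteriorQuasiconformal in
theorem theorem2p2 (K M d : ℝ) (hK : 1 ≤ K) (hd : 0 < d) :
    -- uniform Hölder estimate, with a constant depending only on `K`, `M`, `d`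
    (∃ C : ℝ, ∀ (Ω : Set Plane) (w : Plane → Plane),
      Bornology.IsBounded Ω →
      IsExteriorQuasiconformal K Ω w →
      (∀ x ∈ (closure Ω)ᶜ, ‖w x‖ ≤ M) →
      ∀ Ω' : Set Plane, IsOuterNeighborhood Ω Ω' d →
        ∀ x ∈ (closure Ω')ᶜ, ∀ y ∈ (closure Ω')ᶜ,
          ‖w x - w y‖ ≤ C * ‖x - y‖ ^ qcExponent K) ∧
    -- limit at infinity and decay, with a constant depending only on `K`, `M`, `d`
    -- and on a radius `R` with `Ω ⊆ {|x| ≤ R}`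
    (∀ R : ℝ, 0 < R → ∃ C : ℝ, ∀ (Ω : Set Plane) (w : Plane → Plane),
      Ω ⊆ Metric.closedBall 0 R →
      IsExteriorQuasiconformal K Ω w →
      (∀ x ∈ (closure Ω)ᶜ, ‖w x‖ ≤ M) →
      ∃ wInf : Plane,
        Tendsto w (Bornology.cobounded Plane) (𝓝 wInf) ∧
        ∀ Ω' : Set Plane, IsOuterNeighborhood Ω Ω' d →
          ∀ x ∈ (closure Ω')ᶜ, x ≠ 0 →
            ‖w x - wInf‖ ≤ C * ‖x‖ ^ (-qcExponent K)) := by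
  have hα := qcExponent_pos hK
  have hα1 := qcExponent_le_one hK
  set α := qcExponent K with hαdef
  -- a positive bound is needed, while `M` may be `0`
  set B := max M 1 with hB
  have hB0 : 0 < B := lt_max_of_lt_right one_pos
  have hMB : M ≤ B := le_max_left _ _
  constructor
  · obtain ⟨C, hC, H⟩ := IsQuasiregularOn.exists_holder_const hα hα1
    refine ⟨(C + 2) * B / d ^ α, fun Ω w _ hw hwM Ω' hΩ' x hx y hy => ?_⟩
    have hqr := isQuasiregularOn_toComplex hK hw
    have hball := ball_subset_compl_closure hΩ' hx
    have e : (C + 2) * B / d ^ α * ‖x - y‖ ^ α = (C + 2) * B * (‖x - y‖ / d) ^ α := by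
      rw [Real.div_rpow (norm_nonneg _) hd.le]; ring
    have hX0 : 0 ≤ (‖x - y‖ / d) ^ α := by positivity
    rw [e]
    rcases lt_or_ge ‖x - y‖ d with hlt | hge
    · have hpre : Metric.ball (planeEquiv.symm x) d ⊆ planeEquiv ⁻¹' (closure Ω)ᶜ := by
        intro z hz
        refine hball ?_
        rw [Metric.mem_ball, ← planeEquiv.symm.dist_map, planeEquiv.symm_apply_apply]
        exact hz
      have h1 := H (toComplex w) (planeEquiv.symm x) d B hd hB0 (hqr.mono hpre)
        (fun z hz => by rw [norm_toComplex]; exact (hwM _ (hpre hz)).trans hMB)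
        (planeEquiv.symm y) (by
          rw [Metric.mem_ball, planeEquiv.symm.dist_map, dist_comm, dist_eq_norm]; exact hlt)
      rw [toComplex_symm, toComplex_symm, ← map_sub, ← map_sub, planeEquiv.symm.norm_map,
        planeEquiv.symm.norm_map] at h1
      refine h1.trans ?_
      gcongr
      linarith
    · have hxM := hwM x (hball (Metric.mem_ball_self hd))
      have hyM := hwM y (ball_subset_compl_closure hΩ' hy (Metric.mem_ball_self hd))
      have h1 : 1 ≤ (‖x - y‖ / d) ^ α := Real.one_le_rpow ((one_le_div hd).2 hge) hα.le
      calc ‖w x - w y‖ ≤ ‖w x‖ + ‖w y‖ := norm_sub_le _ _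
        _ ≤ 2 * B * 1 := by linarith
        _ ≤ (C + 2) * B * (‖x - y‖ / d) ^ α := by
            gcongr
            linarith
  · intro R hR
    obtain ⟨C, hC, H⟩ := IsQuasiregularOn.exists_decay_const hα hα1
    refine ⟨(C + 2) * B * R ^ α, fun Ω w hΩ hw hwM => ?_⟩
    have hqr := isQuasiregularOn_toComplex hK hw
    have hext : ∀ x : Plane, R < ‖x‖ → x ∈ (closure Ω)ᶜ := fun x hx hxc => by
      have := closure_minimal hΩ Metric.isClosed_closedBall hxc
      rw [mem_closedBall_zero_iff] at this
      linarith
    have hpre : {z : ℂ | R < ‖z‖} ⊆ planeEquiv ⁻¹' (closure Ω)ᶜ := fun z hz =>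
      hext _ (by rw [planeEquiv.norm_map]; exact hz)
    obtain ⟨l, hl⟩ := H (toComplex w) R B hR hB0 (hqr.mono hpre)
      (fun z hz => by rw [norm_toComplex]; exact (hwM _ (hpre hz)).trans hMB)
    have hl' : ∀ x : Plane, R < ‖x‖ → ‖w x - planeEquiv l‖ ≤ C * B * (R / ‖x‖) ^ α := by
      intro x hx
      have h1 := hl (planeEquiv.symm x) (by rwa [planeEquiv.symm.norm_map])
      rwa [toComplex_symm, planeEquiv.symm.norm_map, ← planeEquiv.norm_map, map_sub,
        planeEquiv.apply_symm_apply] at h1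
    have hlim : Tendsto w (Bornology.cobounded Plane) (𝓝 (planeEquiv l)) := by
      rw [tendsto_iff_norm_sub_tendsto_zero]
      have hnorm : Tendsto (fun x : Plane => ‖x‖) (Bornology.cobounded Plane) atTop :=
        tendsto_norm_cobounded_atTop
      have h0 : Tendsto (fun x : Plane => C * B * (R / ‖x‖) ^ α) (Bornology.cobounded Plane)
          (𝓝 0) := by
        have h1 : Tendsto (fun x : Plane => R / ‖x‖) (Bornology.cobounded Plane) (𝓝 0) :=
          hnorm.const_div_atTop R
        have h2 := (h1.rpow_const (p := α) (Or.inr hα.le)).const_mul (C * B)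
        rwa [Real.zero_rpow hα.ne', mul_zero] at h2
      refine squeeze_zero' (Eventually.of_forall fun _ => norm_nonneg _) ?_ h0
      filter_upwards [hnorm.eventually_gt_atTop R] with x hx using hl' x hx
    have hlB : ‖planeEquiv l‖ ≤ B := by
      have hnorm : Tendsto (fun x : Plane => ‖x‖) (Bornology.cobounded Plane) atTop :=
        tendsto_norm_cobounded_atTop
      refine le_of_tendsto hlim.norm ?_
      filter_upwards [hnorm.eventually_gt_atTop R] with x hx
      exact (hwM x (hext x hx)).trans hMB
    refine ⟨planeEquiv l, hlim, fun Ω' hΩ' x hx hx0 => ?_⟩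
    have hxpos : 0 < ‖x‖ := norm_pos_iff.2 hx0
    have e : (C + 2) * B * R ^ α * ‖x‖ ^ (-α) = (C + 2) * B * (R / ‖x‖) ^ α := by
      rw [Real.div_rpow hR.le hxpos.le, Real.rpow_neg hxpos.le]; ring
    rw [e]
    rcases lt_or_ge R ‖x‖ with hlt | hge
    · refine (hl' x hlt).trans ?_
      gcongr
      linarith
    · have hxM := hwM x (ball_subset_compl_closure hΩ' hx (Metric.mem_ball_self hd))
      have h1 : 1 ≤ (R / ‖x‖) ^ α := Real.one_le_rpow ((one_le_div hxpos).2 hge) hα.le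
      calc ‖w x - planeEquiv l‖ ≤ ‖w x‖ + ‖planeEquiv l‖ := norm_sub_le _ _
        _ ≤ 2 * B * 1 := by linarith
        _ ≤ (C + 2) * B * (R / ‖x‖) ^ α := by
            gcongr
            linarith
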